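/- Let $\beta>1$ be rational and $d\ge 1$ real. A nonzero polynomial $F\in\mathbb R[X,Y]$ is \emph{$\beta$-quasihomogeneous of degree $d$} if $F(tX,t^{\beta}Y)=t^{d}F(X,Y)$ for all $t>0$; its \emph{right} and \emph{left height functions} are the polynomials $f_+(t)=F(1,t)$ and $f_-(t)=F(-1,t)$. Put $V(F)=\{(x,y)\in\mathbb R^2: F(x,y)=0\}$. Two nonzero polynomial functions $f,g:\mathbb R\to\mathbb R$ are \emph{Lipschitz equivalent}, $f\cong g$, if $g\circ\phi=cf$ for some bi-Lipschitz homeomorphism $\phi:\mathbb R\to\mathbb R$ and some constant $c>0$. Two $\beta$-quasihomogeneous polynomials $F,G$ of degree $d$ are \emph{$\mathcal R$-semialgebraically Lipschitz equivalent} if there is a germ of semialgebraic bi-Lipschitz homeomorphism $\Phi=(\Phi_1,\Phi_2):(\mathbb R^2,0)\to(\mathbb R^2,0)$ with $G\circ\Phi=F$ (as germs at $0$); we then say that they are equivalent via $\Phi$. A germ of semialgebraic bi-Lipschitz homeomorphism $\Phi$ is a \emph{$\beta$-isomorphism of degree $d$} if $G'\circ\Phi=F'$ for some $\beta$-quasihomogeneous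 polynomials $F',G'$ of degree $d$ and the limits $\lambda_\pm=\lim_{x\to0^\pm}\Phi_1(x,0)/x$ are nonzero; it is \emph{direct} if $\lambda_+>0$ and $\lambda_->0$, and \emph{reverse} if $\lambda_+<0$ and $\lambda_-<0$. Let $F,G$ be $\beta$-quasihomogeneous of degree $d\ge1$, with height functions $f_\pm$ and $g_\pm$ respectively, and suppose that $V(F)\cap\{x>0\}\ne\emptyset$ and $V(F)\cap\{x<0\}\ne\emptyset$. If $F$ and $G$ are $\mathcal R$-semialgebraically Lipschitz equivalent, then $$(f_+\cong g_+\ \text{ and }\ f_-\cong g_-)\quad\text{or}\quad(f_+\cong g_-\ \text{ and }\ f_-\cong g_+).$$ Moreover, for every germ of semialgebraic bi-Lipschitz homeomorphism $\Phi:(\mathbb R^2,0)\to(\mathbb R^2,0)$ with $G\circ\Phi=F$: if $\Phi$ is direct, then $f_+\cong g_+$ and $f_-\cong g_-$; if $\Phi$ is reverse, then $f_+\cong g_-$ and $f_-\cong g_+$. -/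

import Mathlib

open Filter Topology

namespace LipEq

/-- Semialgebraic subsets of `ℝⁿ`: the smallest family of subsets of `ℝⁿ` that contains all sets
`{p > 0}`, `p` a real polynomial, and is closed under complements and finite unions. -/
inductive IsSemialgebraic {n : ℕ} : Set (Fin n → ℝ) → Prop
  | pos (p : MvPolynomial (Fin n) ℝ) : IsSemialgebraic {x | 0 < MvPolynomial.eval x p}
  | compl (s : Set (Fin n → ℝ)) : IsSemialgebraic s → IsSemialgebraic sᶜ
  | union (s t : Set (Fin n → ℝ)) : IsSemialgebraic s → IsSemialgebraic t →
      IsSemialgebraic (s ∪ t)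

/-- `Φ` is semialgebraic on the semialgebraic set `U ⊆ ℝ²`: its graph over `U` is a semialgebraic
subset of `ℝ⁴`. -/
def IsSemialgebraicMapOn (Φ : (Fin 2 → ℝ) → (Fin 2 → ℝ)) (U : Set (Fin 2 → ℝ)) : Prop :=
  IsSemialgebraic U ∧
    IsSemialgebraic {z : Fin 4 → ℝ | ∃ p ∈ U, z = ![p 0, p 1, Φ p 0, Φ p 1]}

/-- `Φ` represents a germ of semialgebraic bi-Lipschitz homeomorphism `(ℝ², 0) → (ℝ², 0)`:
`Φ 0 = 0`, and `Φ` maps some open neighbourhood `U` of `0` onto an open set, is semialgebraic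
on `U`, and satisfies `A |p - q| ≤ |Φ p - Φ q| ≤ B |p - q|` on `U` for some `A, B > 0`
(so that `Φ : U → Φ(U)` is a homeomorphism). The values of `Φ` outside `U` play no role.
All norms on `ℝ²` are equivalent, so the choice of the norm does not matter here. -/
def IsSemialgBiLipGerm (Φ : (Fin 2 → ℝ) → (Fin 2 → ℝ)) : Prop :=
  Φ 0 = 0 ∧ ∃ U : Set (Fin 2 → ℝ), IsOpen U ∧ (0 : Fin 2 → ℝ) ∈ U ∧ IsOpen (Φ '' U) ∧
    IsSemialgebraicMapOn Φ U ∧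
    ∃ A B : ℝ, 0 < A ∧ 0 < B ∧ ∀ p ∈ U, ∀ q ∈ U,
      A * dist p q ≤ dist (Φ p) (Φ q) ∧ dist (Φ p) (Φ q) ≤ B * dist p q

/-- `F` is a (nonzero) `β`-quasihomogeneous polynomial of degree `d`:
`F(tX, t^β Y) = t^d F(X, Y)` for all `t > 0`. -/
def IsQuasihomogeneous (β : ℚ) (d : ℝ) (F : MvPolynomial (Fin 2) ℝ) : Prop :=
  F ≠ 0 ∧ ∀ t : ℝ, 0 < t → ∀ x y : ℝ,
    MvPolynomial.eval ![t * x, t ^ (β : ℝ) * y] F = t ^ d * MvPolynomial.eval ![x, y] F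

/-- The equality of germs at the origin `G ∘ Φ = F`. -/
def Transforms (Φ : (Fin 2 → ℝ) → (Fin 2 → ℝ)) (F G : MvPolynomial (Fin 2) ℝ) : Prop :=
  ∀ᶠ p in 𝓝 (0 : Fin 2 → ℝ), MvPolynomial.eval (Φ p) G = MvPolynomial.eval p F

/-- `𝓡`-semialgebraic Lipschitz equivalence of polynomials in two variables. -/
def RSemialgLipEquiv (F G : MvPolynomial (Fin 2) ℝ) : Prop :=
  ∃ Φ : (Fin 2 → ℝ) → (Fin 2 → ℝ), IsSemialgBiLipGerm Φ ∧ Transforms Φ F G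

/-- The zero set of `F` in `ℝ²`. -/
def V (F : MvPolynomial (Fin 2) ℝ) : Set (Fin 2 → ℝ) := {p | MvPolynomial.eval p F = 0}

/-- The right height function `f₊(t) = F(1, t)`. -/
noncomputable def rightHeight (F : MvPolynomial (Fin 2) ℝ) : Polynomial ℝ :=
  MvPolynomial.aeval ![1, Polynomial.X] F

/-- The left height function `f₋(t) = F(-1, t)`. -/
noncomputable def leftHeight (F : MvPolynomial (Fin 2) ℝ) : Polynomial ℝ :=
  MvPolynomial.aeval ![-1, Polynomial.X] F

theorem eval_rightHeight (F : MvPolynomial (Fin 2) ℝ) (t : ℝ) :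
    (rightHeight F).eval t = MvPolynomial.eval ![1, t] F := by
  induction F using MvPolynomial.induction_on with
  | C a => simp [rightHeight]
  | add p q hp hq => simp_all [rightHeight]
  | mul_X p i hp => fin_cases i <;> simp_all [rightHeight]

theorem eval_leftHeight (F : MvPolynomial (Fin 2) ℝ) (t : ℝ) :
    (leftHeight F).eval t = MvPolynomial.eval ![-1, t] F := by
  induction F using MvPolynomial.induction_on with
  | C a => simp [leftHeight]
  | add p q hp hq => simp_all [leftHeight]
  | mul_X p i hp => fin_cases i <;> simp_all [leftHeight]

/-- Lipschitz equivalence `f ≅ g` of two nonzero polynomial functions `ℝ → ℝ`: there are a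
bi-Lipschitz homeomorphism `φ : ℝ → ℝ` and a constant `c > 0` with `g ∘ φ = c f`. -/
def PolyLipEquiv (f g : Polynomial ℝ) : Prop :=
  f ≠ 0 ∧ g ≠ 0 ∧ ∃ φ : ℝ ≃ₜ ℝ,
    (∃ A B : ℝ, 0 < A ∧ 0 < B ∧ ∀ s t : ℝ,
      A * |s - t| ≤ |φ s - φ t| ∧ |φ s - φ t| ≤ B * |s - t|) ∧
    ∃ c : ℝ, 0 < c ∧ ∀ t : ℝ, g.eval (φ t) = c * f.eval t

/-- `λ₊` is the limit of `Φ₁(x, 0) / x` as `x → 0⁺`. -/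
def HasRightSpeed (Φ : (Fin 2 → ℝ) → (Fin 2 → ℝ)) (l : ℝ) : Prop :=
  Tendsto (fun x : ℝ => Φ ![x, 0] 0 / x) (𝓝[>] 0) (𝓝 l)

/-- `λ₋` is the limit of `Φ₁(x, 0) / x` as `x → 0⁻`. -/
def HasLeftSpeed (Φ : (Fin 2 → ℝ) → (Fin 2 → ℝ)) (l : ℝ) : Prop :=
  Tendsto (fun x : ℝ => Φ ![x, 0] 0 / x) (𝓝[<] 0) (𝓝 l)

/-- `Φ` is (a representative of) a `β`-isomorphism of degree `d`. -/
def IsBetaIso (β : ℚ) (d : ℝ) (Φ : (Fin 2 → ℝ) → (Fin 2 → ℝ)) : Prop :=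
  IsSemialgBiLipGerm Φ ∧
    (∃ F G : MvPolynomial (Fin 2) ℝ,
      IsQuasihomogeneous β d F ∧ IsQuasihomogeneous β d G ∧ Transforms Φ F G) ∧
    (∃ l : ℝ, l ≠ 0 ∧ HasRightSpeed Φ l) ∧ (∃ l : ℝ, l ≠ 0 ∧ HasLeftSpeed Φ l)

/-- `Φ` is a direct `β`-isomorphism of degree `d`. -/
def IsDirect (β : ℚ) (d : ℝ) (Φ : (Fin 2 → ℝ) → (Fin 2 → ℝ)) : Prop :=
  IsBetaIso β d Φ ∧
    (∃ l : ℝ, 0 < l ∧ HasRightSpeed Φ l) ∧ (∃ l : ℝ, 0 < l ∧ HasLeftSpeed Φ l)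

/-- `Φ` is a reverse `β`-isomorphism of degree `d`. -/
def IsReverse (β : ℚ) (d : ℝ) (Φ : (Fin 2 → ℝ) → (Fin 2 → ℝ)) : Prop :=
  IsBetaIso β d Φ ∧
    (∃ l : ℝ, l < 0 ∧ HasRightSpeed Φ l) ∧ (∃ l : ℝ, l < 0 ∧ HasLeftSpeed Φ l)

end LipEq

namespace LipEq

/-! ### Bi-Lipschitz maps of the line and of the plane -/

/-! Follow a zero branch `x ↦ (e x, x ^ β t₀)` of `F`, with `e = ±1`, and magnify `Φ` around it by
the factor `x ^ (-β)` (`exists_blowup`). Along an ultrafilter the magnified maps converge to a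
bi-Lipschitz map `H` of the plane. What this says about `F` and `G` depends on where `Φ` sends the
branch.

Regular case (`polyLipEquiv_of_regular`): the image meets an open half-plane of sign `e'` at
arbitrarily small scales. The image points are zeros of `G`, so they lie within `O(|u| ^ β)` of the
x-axis, and dividing `G ∘ Φ = F` by `x ^ d` gives in the limit `G(l, ν + H₂(r, t)) = F(e, t)`. Hence
`H₂` is independent of `r`, and `t ↦ H₂(0, t)` is bi-Lipschitz and, up to an affine change, carries
one height function to a multiple of the other.

Exceptional case (`exists_of_exceptional`): the image meets the y-axis at arbitrarily small scales.
Comparing orders in `x` forces a dominant monomial `c X ^ k Y ^ k` in `G` and makes the height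
function equivalent to `c X ^ k`. This rigidity passes to the other height function of `F`
(`exists_of_height_equiv_pow`) and, through the inverse germ, to those of `G`
(`exists_zero_height`), so that all four are equivalent (`polyLipEquiv_of_exceptional`).

If both branches are regular they go to opposite half-planes (`not_same_sign`), which gives the
dichotomy. For a direct or reverse germ the limit speeds make every branch regular and fix the signs
(`eventually_pos_of_speed`). -/

theorem surjective_of_antilipschitz {τ : ℝ → ℝ} {A : ℝ} (hA : 0 < A) (hc : Continuous τ)
    (h : ∀ s t, A * |s - t| ≤ |τ s - τ t|) : Function.Surjective τ := by
  have hinj : Function.Injective τ := fun s t hst => by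
    have := h s t
    rw [hst, sub_self, abs_zero] at this
    exact sub_eq_zero.1 (abs_nonpos_iff.1 (by nlinarith [abs_nonneg (s - t)]))
  -- A continuous injection of the line is strictly monotone; up to sign it increases, and the lower
  -- bound forces at least linear growth at both ends.
  have key : ∀ σ : ℝ → ℝ, Continuous σ → StrictMono σ →
      (∀ s t, A * |s - t| ≤ |σ s - σ t|) → Function.Surjective σ := by
    intro σ hσ hm hs
    refine hσ.surjective ?_ ?_
    · have h1 : Tendsto (fun t : ℝ => A * t + σ 0) atTop atTop :=
        tendsto_atTop_add_const_right _ _ (tendsto_id.const_mul_atTop hA)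
      refine tendsto_atTop_mono' _ ?_ h1
      filter_upwards [eventually_ge_atTop 0] with t ht
      have h2 := hs t 0
      have h3 := hm.monotone ht
      rw [abs_of_nonneg (by linarith), abs_of_nonneg (by linarith)] at h2
      linarith
    · have h1 : Tendsto (fun t : ℝ => A * t + σ 0) atBot atBot :=
        tendsto_atBot_add_const_right _ _ (tendsto_id.const_mul_atBot hA)
      refine tendsto_atBot_mono' _ ?_ h1
      filter_upwards [eventually_le_atBot 0] with t ht
      have h2 := hs t 0
      have h3 := hm.monotone ht
      rw [abs_of_nonpos (by linarith), abs_of_nonpos (by linarith)] at h2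
      linarith
  rcases hc.strictMono_of_inj hinj with hm | hm
  · exact key τ hc hm h
  · have := key (fun t => -τ t) hc.neg hm.neg (fun s t => by
      rw [neg_sub_neg, abs_sub_comm (τ t)]; exact h s t)
    intro y
    obtain ⟨t, ht⟩ := this (-y)
    exact ⟨t, neg_injective ht⟩

theorem continuous_of_lipschitz_bound {τ : ℝ → ℝ} {B : ℝ} (hB : 0 < B)
    (h : ∀ s t, |τ s - τ t| ≤ B * |s - t|) : Continuous τ :=
  (LipschitzWith.of_dist_le_mul (K := ⟨B, hB.le⟩) fun s t => by
    rw [Real.dist_eq, Real.dist_eq]; exact h s t).continuous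

theorem exists_homeomorph_of_biLip {τ : ℝ → ℝ} {A B : ℝ} (hA : 0 < A) (hB : 0 < B)
    (h : ∀ s t, A * |s - t| ≤ |τ s - τ t| ∧ |τ s - τ t| ≤ B * |s - t|) :
    ∃ φ : ℝ ≃ₜ ℝ, ∀ t, φ t = τ t := by
  have hL : LipschitzWith ⟨B, hB.le⟩ τ := LipschitzWith.of_dist_le_mul fun s t => by
    rw [Real.dist_eq, Real.dist_eq]; exact (h s t).2
  have hAL : AntilipschitzWith ⟨A⁻¹, (inv_pos.2 hA).le⟩ τ :=
    AntilipschitzWith.of_le_mul_dist fun s t => by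
      have := (h s t).1
      rw [Real.dist_eq, Real.dist_eq]
      change |s - t| ≤ A⁻¹ * |τ s - τ t|
      rw [inv_mul_eq_div, le_div_iff₀ hA]
      linarith
  have hE := hAL.isClosedEmbedding hL.uniformContinuous
  exact ⟨hE.isEmbedding.toHomeomorphOfSurjective
    (surjective_of_antilipschitz hA hL.continuous fun s t => (h s t).1), fun t => rfl⟩

theorem PolyLipEquiv.of_biLip {f g : Polynomial ℝ} (hf : f ≠ 0) (hg : g ≠ 0) {τ : ℝ → ℝ}
    {A B : ℝ} (hA : 0 < A) (hB : 0 < B)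
    (h : ∀ s t, A * |s - t| ≤ |τ s - τ t| ∧ |τ s - τ t| ≤ B * |s - t|)
    {c : ℝ} (hc : 0 < c) (hfg : ∀ t, g.eval (τ t) = c * f.eval t) : PolyLipEquiv f g := by
  obtain ⟨φ, hφ⟩ := exists_homeomorph_of_biLip hA hB h
  refine ⟨hf, hg, φ, ⟨A, B, hA, hB, ?_⟩, c, hc, ?_⟩
  · simpa only [hφ] using h
  · simpa only [hφ] using hfg

theorem PolyLipEquiv.of_smul {f g : Polynomial ℝ} (hf : f ≠ 0) (hg : g ≠ 0) {a c : ℝ}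
    (ha : a ≠ 0) (hc : 0 < c) (hfg : ∀ t, g.eval (a * t) = c * f.eval t) : PolyLipEquiv f g :=
  .of_biLip hf hg (abs_pos.2 ha) (abs_pos.2 ha)
    (fun s t => by rw [← mul_sub, abs_mul]; exact ⟨le_rfl, le_rfl⟩) hc hfg

theorem PolyLipEquiv.symm {f g : Polynomial ℝ} (h : PolyLipEquiv f g) : PolyLipEquiv g f := by
  obtain ⟨hf, hg, φ, ⟨A, B, hA, hB, hφ⟩, c, hc, h⟩ := h
  refine ⟨hg, hf, φ.symm, ⟨B⁻¹, A⁻¹, inv_pos.2 hB, inv_pos.2 hA, fun s t => ?_⟩, c⁻¹,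
    inv_pos.2 hc, fun t => ?_⟩
  · have := hφ (φ.symm s) (φ.symm t)
    simp only [φ.apply_symm_apply] at this
    rw [inv_mul_eq_div, inv_mul_eq_div, div_le_iff₀ hB, le_div_iff₀ hA]
    constructor <;> linarith [this.1, this.2]
  · have := h (φ.symm t)
    rw [φ.apply_symm_apply] at this
    rw [this, inv_mul_cancel_left₀ hc.ne']

theorem PolyLipEquiv.trans {f g k : Polynomial ℝ} (h : PolyLipEquiv f g)
    (h' : PolyLipEquiv g k) : PolyLipEquiv f k := by
  obtain ⟨hf, hg, φ, ⟨A, B, hA, hB, hφ⟩, c, hc, h⟩ := h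
  obtain ⟨-, hk, φ', ⟨A', B', hA', hB', hφ'⟩, c', hc', h'⟩ := h'
  refine .of_biLip hf hk (τ := fun t => φ' (φ t)) (mul_pos hA' hA) (mul_pos hB' hB)
    (fun s t => ⟨?_, ?_⟩) (mul_pos hc' hc) (fun t => by rw [h', h, mul_assoc])
  · rw [mul_assoc]
    exact (mul_le_mul_of_nonneg_left (hφ s t).1 hA'.le).trans (hφ' _ _).1
  · rw [mul_assoc]
    exact (hφ' _ _).2.trans (mul_le_mul_of_nonneg_left (hφ s t).2 hB'.le)

theorem dist_fin_two (p q : Fin 2 → ℝ) : dist p q = max |p 0 - q 0| |p 1 - q 1| := by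
  apply le_antisymm
  · rw [dist_pi_le_iff (le_max_of_le_left (abs_nonneg _))]
    intro i
    fin_cases i
    · exact le_max_left _ _
    · exact le_max_right _ _
  · exact max_le (dist_le_pi_dist p q 0) (dist_le_pi_dist p q 1)

theorem abs_sub_le_dist (p q : Fin 2 → ℝ) (i : Fin 2) : |p i - q i| ≤ dist p q :=
  dist_le_pi_dist p q i

theorem eq_of_continuous_of_finite {τ : ℝ → ℝ} (hτ : Continuous τ) {S : Set ℝ} (hS : S.Finite)
    (h : ∀ t, τ t ∈ S) (s t : ℝ) : τ s = τ t := by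
  have h1 : (Set.range τ).Subsingleton :=
    hS.countable.isTotallyDisconnected _ (by rintro _ ⟨t, rfl⟩; exact h t)
      (isPreconnected_range hτ)
  exact h1 ⟨s, rfl⟩ ⟨t, rfl⟩

theorem finite_setOf_eval_eq {P : Polynomial ℝ} {u v : ℝ} (hP : P.eval u ≠ P.eval v) (y : ℝ) :
    {x | P.eval x = y}.Finite := by
  have : P - Polynomial.C y ≠ 0 := by
    intro h
    have h1 := congrArg (Polynomial.eval u) h
    have h2 := congrArg (Polynomial.eval v) h
    simp only [Polynomial.eval_sub, Polynomial.eval_C, Polynomial.eval_zero] at h1 h2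
    exact hP (by linarith)
  refine (P - Polynomial.C y).roots.toFinset.finite_toSet.subset fun x hx => ?_
  simp [this, Polynomial.IsRoot, sub_eq_zero.2 (show P.eval x = y from hx)]

/-- A bi-Lipschitz map of the plane one of whose components `H · i` satisfies `P ∘ (H · i) = f`
with `P` a nonconstant polynomial and `f` a function of the second variable induces a
bi-Lipschitz map of the line. -/
theorem biLip_component {H : ℝ → ℝ → Fin 2 → ℝ} {A B : ℝ} (hA : 0 < A) (hB : 0 < B)
    (hH : ∀ r t r' t', A * max |r - r'| |t - t'| ≤ dist (H r t) (H r' t') ∧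
      dist (H r t) (H r' t') ≤ B * max |r - r'| |t - t'|)
    (i : Fin 2) {P : Polynomial ℝ} {u v : ℝ} (hP : P.eval u ≠ P.eval v) {f : ℝ → ℝ}
    (hf : ∀ r t, P.eval (H r t i) = f t) (s t : ℝ) :
    A * |s - t| ≤ |H 0 s i - H 0 t i| ∧ |H 0 s i - H 0 t i| ≤ B * |s - t| := by
  have hup : ∀ (j : Fin 2) r t r' t', |H r t j - H r' t' j| ≤ B * max |r - r'| |t - t'| :=
    fun j r t r' t' => (abs_sub_le_dist _ _ j).trans (hH r t r' t').2
  have hcont : ∀ (j : Fin 2) (t : ℝ), Continuous fun r => H r t j := fun j t =>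
    continuous_of_lipschitz_bound hB fun r r' => by simpa using hup j r t r' t
  -- For fixed `t` the component moves continuously inside a finite level set of `P`, so it does not
  -- depend on `r`.
  have hconst : ∀ r r' t, H r t i = H r' t i := fun r r' t =>
    eq_of_continuous_of_finite (hcont i t) (finite_setOf_eval_eq hP (f t)) (fun r => hf r t) r r'
  obtain ⟨j, hj⟩ : ∃ j : Fin 2, ∀ p q : Fin 2 → ℝ, dist p q = max |p j - q j| |p i - q i| := by
    fin_cases i
    · exact ⟨1, fun p q => by rw [dist_fin_two, max_comm]; rfl⟩
    · exact ⟨0, dist_fin_two⟩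
  refine ⟨?_, by simpa using hup i 0 s 0 t⟩
  -- The other component `j` then carries the whole lower bound in `r`, so it is onto. Moving along
  -- `r` makes the `j` components agree without changing the `i` component, which must therefore
  -- account for the full distance.
  obtain ⟨r, hr⟩ := surjective_of_antilipschitz hA (hcont j s) (fun r r' => by
    have := (hH r s r' s).1
    rw [hj, hconst r r' s] at this
    simpa using this) (H 0 t j)
  have := (hH r s 0 t).1
  rw [hj, hconst r 0 s] at this
  rw [show H r s j = H 0 t j from hr, sub_self, abs_zero, max_eq_right (abs_nonneg (H 0 s i - H 0 t i))] at this
  exact (mul_le_mul_of_nonneg_left (le_max_right _ _) hA.le).trans this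

/-! ### Germs of bi-Lipschitz maps -/

/-- Bi-Lipschitz germs at the origin of the plane, not assumed semialgebraic or onto. -/
def IsBiLipGerm (Φ : (Fin 2 → ℝ) → (Fin 2 → ℝ)) : Prop :=
  Φ 0 = 0 ∧ ∃ A B : ℝ, 0 < A ∧ 0 < B ∧ ∃ U ∈ 𝓝 (0 : Fin 2 → ℝ), ∀ p ∈ U, ∀ q ∈ U,
    A * dist p q ≤ dist (Φ p) (Φ q) ∧ dist (Φ p) (Φ q) ≤ B * dist p q

theorem IsSemialgBiLipGerm.isBiLipGerm {Φ : (Fin 2 → ℝ) → (Fin 2 → ℝ)}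
    (h : IsSemialgBiLipGerm Φ) : IsBiLipGerm Φ := by
  obtain ⟨h0, U, hU, h0U, -, -, A, B, hA, hB, h⟩ := h
  exact ⟨h0, A, B, hA, hB, U, hU.mem_nhds h0U, h⟩

theorem IsBiLipGerm.continuousAt {Φ : (Fin 2 → ℝ) → (Fin 2 → ℝ)} (h : IsBiLipGerm Φ) :
    Tendsto Φ (𝓝 0) (𝓝 0) := by
  obtain ⟨h0, A, B, hA, hB, U, hU, h⟩ := h
  rw [tendsto_iff_dist_tendsto_zero]
  have : Tendsto (fun p : Fin 2 → ℝ => B * dist p 0) (𝓝 0) (𝓝 0) := by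
    have : Continuous fun p : Fin 2 → ℝ => B * dist p 0 := by fun_prop
    simpa using this.tendsto 0
  refine squeeze_zero' (Eventually.of_forall fun _ => dist_nonneg) ?_ this
  filter_upwards [hU] with p hp
  have := (h p hp 0 (mem_of_mem_nhds hU)).2
  rwa [h0] at this

/-- Allows the branch analysis to be run with `F` and `G` exchanged. Openness of `Φ '' U` makes the
inverse defined near the origin. -/
theorem IsSemialgBiLipGerm.exists_inverse {Φ : (Fin 2 → ℝ) → (Fin 2 → ℝ)}
    (h : IsSemialgBiLipGerm Φ) :
    ∃ Ψ, IsBiLipGerm Ψ ∧ ∀ᶠ q in 𝓝 0, Φ (Ψ q) = q := by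
  obtain ⟨h0, U, hU, h0U, hV, -, A, B, hA, hB, h⟩ := h
  have hinj : Set.InjOn Φ U := fun p hp q hq hpq => by
    have := (h p hp q hq).1
    rw [hpq, dist_self] at this
    exact dist_le_zero.1 (by nlinarith [dist_nonneg (x := p) (y := q)])
  have hr : ∀ q ∈ Φ '' U, Φ (Function.invFunOn Φ U q) = q := fun q hq =>
    Function.invFunOn_eq hq
  have hm : ∀ q ∈ Φ '' U, Function.invFunOn Φ U q ∈ U := fun q hq =>
    Function.invFunOn_mem hq
  have h0V : (0 : Fin 2 → ℝ) ∈ Φ '' U := ⟨0, h0U, h0⟩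
  refine ⟨Function.invFunOn Φ U, ⟨hinj (hm 0 h0V) h0U (by rw [hr 0 h0V, h0]), B⁻¹, A⁻¹,
    inv_pos.2 hB, inv_pos.2 hA, Φ '' U, hV.mem_nhds h0V, fun p hp q hq => ?_⟩,
    eventually_of_mem (hV.mem_nhds h0V) hr⟩
  have := h _ (hm p hp) _ (hm q hq)
  rw [hr p hp, hr q hq] at this
  rw [inv_mul_eq_div, inv_mul_eq_div, div_le_iff₀ hB, le_div_iff₀ hA]
  constructor <;> linarith [this.1, this.2]

theorem Transforms.inverse {Φ Ψ : (Fin 2 → ℝ) → (Fin 2 → ℝ)} {F G : MvPolynomial (Fin 2) ℝ}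
    (h : Transforms Φ F G) (hΨ : IsBiLipGerm Ψ) (hΦΨ : ∀ᶠ q in 𝓝 0, Φ (Ψ q) = q) :
    Transforms Ψ G F := by
  filter_upwards [hΨ.continuousAt.eventually h, hΦΨ] with q h1 h2
  rw [← h1, h2]

/-- Replaces extraction of subsequences: one ultrafilter gives limits simultaneously for all
parameters `(r, t)`. -/
theorem Ultrafilter.exists_tendsto_of_bounded {U : Ultrafilter ℝ} {E : Type*}
    [PseudoMetricSpace E] [ProperSpace E] {w : ℝ → E} {a : E} {C : ℝ}
    (h : ∀ᶠ x in (U : Filter ℝ), dist (w x) a ≤ C) : ∃ l, Tendsto w U (𝓝 l) := by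
  obtain ⟨l, -, hl⟩ := (isCompact_closedBall a C).ultrafilter_le_nhds (U.map w)
    (by rw [le_principal_iff]; exact h)
  exact ⟨l, hl⟩

/-! ### Quasihomogeneous polynomials and their height functions -/

/-- The height function `t ↦ F(e, t)`. -/
noncomputable def height (F : MvPolynomial (Fin 2) ℝ) (e : ℝ) : Polynomial ℝ :=
  MvPolynomial.aeval ![Polynomial.C e, Polynomial.X] F

theorem rightHeight_eq (F : MvPolynomial (Fin 2) ℝ) : rightHeight F = height F 1 := by
  simp [rightHeight, height]

theorem leftHeight_eq (F : MvPolynomial (Fin 2) ℝ) : leftHeight F = height F (-1) := by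
  simp [leftHeight, height]

theorem eval_pair (F : MvPolynomial (Fin 2) ℝ) (p : Fin 2 → ℝ) :
    MvPolynomial.eval p F = ∑ m ∈ F.support, F.coeff m * (p 0 ^ m 0 * p 1 ^ m 1) := by
  simp [MvPolynomial.eval_eq']

theorem height_eq_sum (F : MvPolynomial (Fin 2) ℝ) (e : ℝ) :
    height F e = ∑ m ∈ F.support, Polynomial.C (F.coeff m * e ^ m 0) * Polynomial.X ^ m 1 := by
  rw [height, MvPolynomial.aeval_eq_eval₂Hom, MvPolynomial.coe_eval₂Hom,
    MvPolynomial.eval₂_eq']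
  simp [mul_assoc]

theorem eval_height (F : MvPolynomial (Fin 2) ℝ) (e t : ℝ) :
    (height F e).eval t = MvPolynomial.eval ![e, t] F := by
  rw [height_eq_sum, eval_pair, Polynomial.eval_finsetSum]
  simp [mul_assoc]

theorem continuous_eval (F : MvPolynomial (Fin 2) ℝ) :
    Continuous fun p : Fin 2 → ℝ => MvPolynomial.eval p F := by
  simp only [eval_pair]
  fun_prop

namespace IsQuasihomogeneous

variable {β : ℚ} {d : ℝ} {F : MvPolynomial (Fin 2) ℝ}

theorem exponent_eq (hF : IsQuasihomogeneous β d F) {m : Fin 2 →₀ ℕ} (hm : m ∈ F.support) :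
    (m 0 : ℝ) + β * m 1 = d := by
  -- The scaling identity at the single value `t = 2`, read as an identity of polynomials, already
  -- determines the weight of each monomial.
  have key : ∑ k ∈ F.support, MvPolynomial.monomial k
      (F.coeff k * ((2 : ℝ) ^ k 0 * ((2 : ℝ) ^ (β : ℝ)) ^ k 1)) =
      MvPolynomial.C ((2 : ℝ) ^ d) * F := by
    refine MvPolynomial.funext fun p => ?_
    have h := hF.2 2 two_pos (p 0) (p 1)
    have hp : ![p 0, p 1] = p := by ext i; fin_cases i <;> rfl
    rw [hp] at h
    rw [map_mul, MvPolynomial.eval_C, ← h, map_sum, eval_pair]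
    refine Finset.sum_congr rfl fun k _ => ?_
    rw [MvPolynomial.eval_monomial, Finsupp.prod_fintype _ _ (by simp)]
    simp [mul_pow]
    ring
  have h := congrArg (MvPolynomial.coeff m) key
  rw [MvPolynomial.coeff_C_mul, MvPolynomial.coeff_sum] at h
  simp only [MvPolynomial.coeff_monomial] at h
  rw [Finset.sum_ite_eq' F.support m, if_pos hm, mul_comm] at h
  have h2 := mul_right_cancel₀ (MvPolynomial.mem_support_iff.1 hm) h
  rw [← Real.rpow_natCast, ← Real.rpow_natCast, ← Real.rpow_mul two_pos.le,
    ← Real.rpow_add two_pos] at h2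
  exact (Real.rpow_right_inj two_pos (by norm_num)).1 h2

theorem eq_of_apply_one_eq (hF : IsQuasihomogeneous β d F) {m m' : Fin 2 →₀ ℕ}
    (hm : m ∈ F.support) (hm' : m' ∈ F.support) (h : m 1 = m' 1) : m = m' := by
  have h1 := hF.exponent_eq hm
  have h2 := hF.exponent_eq hm'
  rw [h] at h1
  ext i
  fin_cases i
  · exact_mod_cast (by linarith : (m 0 : ℝ) = m' 0)
  · exact h

theorem coeff_height (hF : IsQuasihomogeneous β d F) {m : Fin 2 →₀ ℕ} (hm : m ∈ F.support)
    (e : ℝ) : (height F e).coeff (m 1) = F.coeff m * e ^ m 0 := by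
  rw [height_eq_sum, Polynomial.finsetSum_coeff, Finset.sum_eq_single_of_mem m hm]
  · rw [Polynomial.coeff_C_mul_X_pow, if_pos rfl]
  · intro k hk hkm
    rw [Polynomial.coeff_C_mul_X_pow, if_neg]
    exact fun h => hkm (hF.eq_of_apply_one_eq hk hm h.symm)

theorem exists_of_coeff_height_ne_zero {n : ℕ} {e : ℝ} (h : (height F e).coeff n ≠ 0) :
    ∃ m ∈ F.support, m 1 = n := by
  rw [height_eq_sum, Polynomial.finsetSum_coeff] at h
  obtain ⟨m, hm, hn⟩ := Finset.exists_ne_zero_of_sum_ne_zero h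
  refine ⟨m, hm, ?_⟩
  by_contra hne
  rw [Polynomial.coeff_C_mul_X_pow, if_neg (Ne.symm hne)] at hn
  exact hn rfl

theorem height_ne_zero (hF : IsQuasihomogeneous β d F) {e : ℝ} (he : e ≠ 0) :
    height F e ≠ 0 := by
  obtain ⟨m, hm⟩ := MvPolynomial.support_nonempty.2 hF.1
  intro h
  have h1 := hF.coeff_height hm e
  rw [h, Polynomial.coeff_zero] at h1
  exact mul_ne_zero (MvPolynomial.mem_support_iff.1 hm) (pow_ne_zero _ he) h1.symm

theorem eval_scale (hF : IsQuasihomogeneous β d F) {x : ℝ} (hx : 0 < x) (e t : ℝ) :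
    MvPolynomial.eval ![e * x, x ^ (β : ℝ) * t] F = x ^ d * (height F e).eval t := by
  rw [eval_height, ← hF.2 x hx, mul_comm e]

/-- Reduction of the values of `F` off the `y`-axis to the height functions. -/
theorem eval_eq_height (hF : IsQuasihomogeneous β d F) {e u : ℝ} (he : |e| = 1)
    (hu : 0 < e * u) (v : ℝ) :
    MvPolynomial.eval ![u, v] F = |u| ^ d * (height F e).eval (v / |u| ^ (β : ℝ)) := by
  have hu0 : 0 < |u| := abs_pos.2 (by rintro rfl; simp at hu)
  have h1 : e * |u| = u := by
    have h2 : e * u = |u| := by rw [← abs_of_pos hu, abs_mul, he, one_mul]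
    have h3 : e * e = 1 := by rw [← abs_mul_abs_self, he, one_mul]
    rw [← h2, ← mul_assoc, h3, one_mul]
  rw [← hF.eval_scale hu0, h1, mul_div_cancel₀ _ (Real.rpow_pos_of_pos hu0 _).ne']

end IsQuasihomogeneous

/-! ### Blowing up a bi-Lipschitz germ along a quasihomogeneous curve -/

/-- Points of the plane at scale `x`: shifting `r` by `1` moves the first coordinate by `x ^ β`. -/
noncomputable def chart (β e x r t : ℝ) : Fin 2 → ℝ := ![e * (x + x ^ β * r), x ^ β * t]

theorem dist_chart {β e x : ℝ} (he : |e| = 1) (hx : 0 < x) (r t r' t' : ℝ) :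
    dist (chart β e x r t) (chart β e x r' t') = x ^ β * max |r - r'| |t - t'| := by
  have hp := Real.rpow_pos_of_pos hx β
  rw [dist_fin_two, mul_max_of_nonneg _ _ hp.le]
  congr 1
  · simp only [chart, Matrix.cons_val_zero]
    rw [show e * (x + x ^ β * r) - e * (x + x ^ β * r') = e * (x ^ β * (r - r')) by ring,
      abs_mul, he, one_mul, abs_mul, abs_of_pos hp]
  · simp only [chart, Matrix.cons_val_one, Matrix.cons_val_fin_one]
    rw [← mul_sub, abs_mul, abs_of_pos hp]

theorem tendsto_rpow_zero {β : ℝ} (hβ : 0 < β) : Tendsto (fun x : ℝ => x ^ β) (𝓝[>] 0) (𝓝 0) := by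
  have := (Real.continuousAt_rpow_const 0 β (Or.inr hβ.le)).tendsto
  rw [Real.zero_rpow hβ.ne'] at this
  exact this.mono_left nhdsWithin_le_nhds

theorem tendsto_chart {β e : ℝ} (hβ : 0 < β) (r t : ℝ) :
    Tendsto (fun x => chart β e x r t) (𝓝[>] 0) (𝓝 0) := by
  rw [tendsto_pi_nhds]
  have h1 := tendsto_rpow_zero hβ
  have h2 : Tendsto (fun x : ℝ => x) (𝓝[>] 0) (𝓝 0) := tendsto_id.mono_left nhdsWithin_le_nhds
  intro i
  fin_cases i
  · simpa [chart] using (h2.add (h1.mul_const r)).const_mul e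
  · simpa [chart] using h1.mul_const t

/-- The shift `r` enters only through `x ^ (β - 1) * r`, which vanishes in the limit because `β >
1`; the limit sees only `t`. -/
theorem eval_chart {β : ℚ} {d : ℝ} {F : MvPolynomial (Fin 2) ℝ}
    (hF : IsQuasihomogeneous β d F) {x : ℝ} (hx : 0 < x) (e r t : ℝ) :
    MvPolynomial.eval (chart β e x r t) F =
      x ^ d * MvPolynomial.eval ![e * (1 + x ^ ((β : ℝ) - 1) * r), t] F := by
  rw [← hF.2 x hx, chart]
  congr 3
  rw [Real.rpow_sub_one hx.ne']
  field_simp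

/-- The chart multiplies distances by `x ^ β` and the magnification divides by the same factor, so
the constants of `Φ` survive in the limit. -/
theorem exists_blowup {U : Ultrafilter ℝ} (hU : (U : Filter ℝ) ≤ 𝓝[>] 0) {β e : ℝ} (hβ : 0 < β)
    (he : |e| = 1) {Φ : (Fin 2 → ℝ) → (Fin 2 → ℝ)} (hΦ : IsBiLipGerm Φ) (t₀ : ℝ) :
    ∃ (H : ℝ → ℝ → Fin 2 → ℝ) (A B : ℝ), 0 < A ∧ 0 < B ∧
      (∀ r t, Tendsto (fun x => (x ^ β)⁻¹ • (Φ (chart β e x r t) - Φ (chart β e x 0 t₀))) U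
        (𝓝 (H r t))) ∧
      ∀ r t r' t', A * max |r - r'| |t - t'| ≤ dist (H r t) (H r' t') ∧
        dist (H r t) (H r' t') ≤ B * max |r - r'| |t - t'| := by
  obtain ⟨-, A, B, hA, hB, S, hS, h⟩ := hΦ
  have hpos : ∀ᶠ x in (U : Filter ℝ), 0 < x := hU self_mem_nhdsWithin
  have hmem : ∀ r t, ∀ᶠ x in (U : Filter ℝ), chart β e x r t ∈ S := fun r t =>
    hU ((tendsto_chart hβ r t).eventually_mem hS)
  have hbd : ∀ r t r' t', ∀ᶠ x in (U : Filter ℝ),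
      A * max |r - r'| |t - t'| ≤
        dist ((x ^ β)⁻¹ • (Φ (chart β e x r t) - Φ (chart β e x 0 t₀)))
          ((x ^ β)⁻¹ • (Φ (chart β e x r' t') - Φ (chart β e x 0 t₀))) ∧
      dist ((x ^ β)⁻¹ • (Φ (chart β e x r t) - Φ (chart β e x 0 t₀)))
          ((x ^ β)⁻¹ • (Φ (chart β e x r' t') - Φ (chart β e x 0 t₀))) ≤
        B * max |r - r'| |t - t'| := by
    intro r t r' t'
    filter_upwards [hpos, hmem r t, hmem r' t'] with x hx h1 h2
    have hp := Real.rpow_pos_of_pos hx β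
    have := h _ h1 _ h2
    rw [dist_chart he hx] at this
    rw [dist_smul₀, dist_sub_right, Real.norm_of_nonneg (inv_pos.2 hp).le, inv_mul_eq_div,
      le_div_iff₀ hp, div_le_iff₀ hp]
    constructor <;> linarith [this.1, this.2]
  have hlim : ∀ r t, ∃ l, Tendsto
      (fun x => (x ^ β)⁻¹ • (Φ (chart β e x r t) - Φ (chart β e x 0 t₀))) U (𝓝 l) := by
    intro r t
    refine Ultrafilter.exists_tendsto_of_bounded (a := 0) (C := B * max |r - 0| |t - t₀|) ?_
    filter_upwards [hbd r t 0 t₀] with x hx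
    simpa using hx.2
  choose H hH using hlim
  refine ⟨H, A, B, hA, hB, hH, fun r t r' t' => ?_⟩
  have := (hH r t).dist (hH r' t')
  exact ⟨ge_of_tendsto this ((hbd r t r' t').mono fun _ h => h.1),
    le_of_tendsto this ((hbd r t r' t').mono fun _ h => h.2)⟩

theorem exists_ultrafilter_of_frequently {l : Filter ℝ} {p : ℝ → Prop} (h : ∃ᶠ x in l, p x) :
    ∃ U : Ultrafilter ℝ, (U : Filter ℝ) ≤ l ∧ ∀ᶠ x in (U : Filter ℝ), p x := by
  have := frequently_iff_neBot.1 h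
  have := Ultrafilter.of_le (l ⊓ 𝓟 {x | p x})
  exact ⟨Ultrafilter.of (l ⊓ 𝓟 {x | p x}), this.trans inf_le_left,
    le_principal_iff.1 (this.trans inf_le_right)⟩

theorem exists_bound_roots {g : Polynomial ℝ} (hg : g ≠ 0) :
    ∃ T : ℝ, 0 < T ∧ ∀ t, g.eval t = 0 → |t| ≤ T := by
  obtain ⟨T, hT⟩ := (g.roots.toFinset.image fun t => |t|).bddAbove
  refine ⟨max T 1, by positivity, fun t ht => le_max_of_le_left (hT ?_)⟩
  simp only [Finset.coe_image, Set.mem_image, Finset.mem_coe, Multiset.mem_toFinset]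
  exact ⟨t, (Polynomial.mem_roots hg).2 ht, rfl⟩

theorem exists_eval_ne_zero {f : Polynomial ℝ} (hf : f ≠ 0) : ∃ t, f.eval t ≠ 0 := by
  by_contra! h
  exact hf (Polynomial.funext fun t => by simpa using h t)

/-- The branch is tangent to the x-axis, so its distance to the origin is comparable to `x`, and so
is that of its image. -/
theorem IsBiLipGerm.curve_bounds {Φ : (Fin 2 → ℝ) → (Fin 2 → ℝ)} (hΦ : IsBiLipGerm Φ)
    {β e : ℝ} (hβ : 1 < β) (he : |e| = 1) (t₀ : ℝ) :
    ∃ A B : ℝ, 0 < A ∧ 0 < B ∧ ∀ᶠ x in 𝓝[>] (0 : ℝ),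
      A * x ≤ max |Φ (chart β e x 0 t₀) 0| |Φ (chart β e x 0 t₀) 1| ∧
      max |Φ (chart β e x 0 t₀) 0| |Φ (chart β e x 0 t₀) 1| ≤ B * x := by
  obtain ⟨h0, A, B, hA, hB, S, hS, h⟩ := hΦ
  refine ⟨A, B * (1 + |t₀|), hA, by positivity, ?_⟩
  filter_upwards [(tendsto_chart (β := β) (e := e) (by linarith) 0 t₀).eventually_mem hS, self_mem_nhdsWithin,
    Ioo_mem_nhdsGT one_pos] with x hx (hx0 : 0 < x) hx1
  have h1 := h _ hx 0 (mem_of_mem_nhds hS)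
  rw [h0, dist_fin_two, dist_fin_two] at h1
  simp only [Pi.zero_apply, sub_zero] at h1
  have h2 : |chart β e x 0 t₀ 0| = x := by simp [chart, abs_mul, he, abs_of_pos hx0]
  have h3 : |chart β e x 0 t₀ 1| ≤ x * |t₀| := by
    simp only [chart, Matrix.cons_val_one, Matrix.cons_val_fin_one, abs_mul]
    refine mul_le_mul_of_nonneg_right ?_ (abs_nonneg _)
    rw [abs_of_pos (Real.rpow_pos_of_pos hx0 _)]
    simpa using Real.rpow_le_rpow_of_exponent_ge hx0 hx1.2.le hβ.le
  rw [h2] at h1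
  refine ⟨(mul_le_mul_of_nonneg_left (le_max_left _ _) hA.le).trans h1.1, h1.2.trans ?_⟩
  rw [mul_assoc]
  refine mul_le_mul_of_nonneg_left (max_le ?_ ?_) hB.le <;> nlinarith [abs_nonneg t₀]

/-! ### Branches mapped into an open half-plane -/

section

variable {β : ℚ} {d : ℝ} {F G : MvPolynomial (Fin 2) ℝ} {Φ : (Fin 2 → ℝ) → (Fin 2 → ℝ)}

theorem eval_curve (hF : IsQuasihomogeneous β d F) {x : ℝ} (hx : 0 < x) (e t : ℝ) :
    MvPolynomial.eval (chart β e x 0 t) F = x ^ d * (height F e).eval t := by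
  rw [eval_chart hF hx, eval_height]
  simp

theorem tendsto_eval_chart (hβ : 1 < β) (F : MvPolynomial (Fin 2) ℝ) (e r t : ℝ) :
    Tendsto (fun x : ℝ => MvPolynomial.eval ![e * (1 + x ^ ((β : ℝ) - 1) * r), t] F) (𝓝[>] 0)
      (𝓝 ((height F e).eval t)) := by
  have hβ' : (0 : ℝ) < β - 1 := by
    have : (1 : ℝ) < β := by exact_mod_cast hβ
    linarith
  rw [eval_height]
  refine ((continuous_eval F).tendsto ![e, t]).comp (tendsto_pi_nhds.2 fun i => ?_)
  fin_cases i
  · simpa using (((tendsto_rpow_zero hβ').mul_const r).const_add 1).const_mul e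
  · simp

/-- The zeros of `G` off the `y`-axis are tangent to the `x`-axis. -/
theorem exists_bound_zeros (hG : IsQuasihomogeneous β d G) {e : ℝ} (he : |e| = 1) :
    ∃ T : ℝ, 0 < T ∧ ∀ p : Fin 2 → ℝ, 0 < e * p 0 → MvPolynomial.eval p G = 0 →
      |p 1| ≤ T * |p 0| ^ (β : ℝ) := by
  have he0 : e ≠ 0 := by rintro rfl; simp at he
  obtain ⟨T, hT0, hT⟩ := exists_bound_roots (hG.height_ne_zero he0)
  refine ⟨T, hT0, fun p hp h => ?_⟩
  have hu : 0 < |p 0| := abs_pos.2 (by intro h; simp [h] at hp)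
  have hp' : ![p 0, p 1] = p := by ext i; fin_cases i <;> rfl
  rw [← hp', hG.eval_eq_height he hp] at h
  have := hT _ ((mul_eq_zero.1 h).resolve_left (Real.rpow_pos_of_pos hu _).ne')
  rwa [abs_div, abs_of_pos (Real.rpow_pos_of_pos hu _),
    div_le_iff₀ (Real.rpow_pos_of_pos hu _)] at this

theorem polyLipEquiv_of_regular (hβ : 1 < β) (hF : IsQuasihomogeneous β d F)
    (hG : IsQuasihomogeneous β d G) (hΦ : IsBiLipGerm Φ) (hT : Transforms Φ F G) {e e' : ℝ}
    (he : |e| = 1) (he' : |e'| = 1) {t₀ : ℝ} (ht₀ : (height F e).eval t₀ = 0)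
    (hfr : ∃ᶠ x in 𝓝[>] 0, 0 < e' * Φ (chart β e x 0 t₀) 0) :
    PolyLipEquiv (height F e) (height G e') := by
  have hβ1 : (1 : ℝ) < β := by exact_mod_cast hβ
  have he0 : e ≠ 0 := by rintro rfl; simp at he
  have he0' : e' ≠ 0 := by rintro rfl; simp at he'
  have hf0 := hF.height_ne_zero he0
  obtain ⟨U, hU, hpos⟩ := exists_ultrafilter_of_frequently hfr
  have hx0 : ∀ᶠ x in (U : Filter ℝ), 0 < x := hU self_mem_nhdsWithin
  obtain ⟨T, hT0, hTb⟩ := exists_bound_zeros hG he'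
  obtain ⟨A, B, hA, hB, hAB⟩ := hΦ.curve_bounds hβ1 he t₀
  have hcurve : Tendsto (fun x => Φ (chart β e x 0 t₀)) U (𝓝 0) :=
    hΦ.continuousAt.comp ((tendsto_chart (by linarith) 0 t₀).mono_left hU)
  have htr : ∀ r t, ∀ᶠ x in (U : Filter ℝ), MvPolynomial.eval (Φ (chart β e x r t)) G =
      MvPolynomial.eval (chart β e x r t) F := fun r t =>
    ((tendsto_chart (by linarith) r t).mono_left hU).eventually hT
  -- Makes the image point closer to the x-axis than to the y-axis, so that the lower bound of
  -- `curve_bounds` falls on its first coordinate and the limit `l` is nonzero.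
  have hsmall : ∀ᶠ x in (U : Filter ℝ), T * |Φ (chart β e x 0 t₀) 0| ^ ((β : ℝ) - 1) < 1 := by
    have h1 : Tendsto (fun x => T * |Φ (chart β e x 0 t₀) 0| ^ ((β : ℝ) - 1)) U (𝓝 0) := by
      have h2 := ((tendsto_pi_nhds.1 hcurve 0).abs.rpow_const
        (p := (β : ℝ) - 1) (Or.inr (by linarith))).const_mul T
      simpa [Real.zero_rpow (by linarith : (β : ℝ) - 1 ≠ 0)] using h2
    exact h1.eventually_lt_const one_pos
  have hest : ∀ᶠ x in (U : Filter ℝ), A ≤ e' * (Φ (chart β e x 0 t₀) 0 / x) ∧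
      |Φ (chart β e x 0 t₀) 0 / x| ≤ B ∧
      |Φ (chart β e x 0 t₀) 1 / x ^ (β : ℝ)| ≤ T * B ^ (β : ℝ) := by
    filter_upwards [hpos, hx0, hU hAB, htr 0 t₀, hsmall] with x hx hx0 hab hz hs
    rw [eval_curve hF hx0, ht₀, mul_zero] at hz
    have h1 := hTb _ hx hz
    set u := Φ (chart β e x 0 t₀) 0
    set v := Φ (chart β e x 0 t₀) 1
    have hu : 0 < |u| := abs_pos.2 (by intro h; simp [h] at hx)
    have h2 : |v| ≤ |u| := by
      rw [Real.rpow_sub_one hu.ne', ← mul_div_assoc, div_lt_one hu] at hs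
      exact h1.trans hs.le
    rw [max_eq_left h2] at hab
    have h3 : |u| = e' * u := by rw [← abs_of_pos hx, abs_mul, he', one_mul]
    have hxp := Real.rpow_pos_of_pos hx0 (β : ℝ)
    refine ⟨?_, ?_, ?_⟩
    · rw [← mul_div_assoc, ← h3, le_div_iff₀ hx0]
      exact hab.1
    · rw [abs_div, abs_of_pos hx0, div_le_iff₀ hx0]
      exact hab.2
    · rw [abs_div, abs_of_pos hxp, div_le_iff₀ hxp, mul_assoc, ← Real.mul_rpow hB.le hx0.le]
      exact h1.trans (mul_le_mul_of_nonneg_left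
        (Real.rpow_le_rpow hu.le hab.2 (by linarith)) hT0.le)
  obtain ⟨l, hl⟩ := Ultrafilter.exists_tendsto_of_bounded (a := (0 : ℝ)) (C := B)
    (w := fun x => Φ (chart β e x 0 t₀) 0 / x)
    (hest.mono fun x h => by rw [Real.dist_eq, sub_zero]; exact h.2.1)
  obtain ⟨ν, hν⟩ := Ultrafilter.exists_tendsto_of_bounded (a := (0 : ℝ)) (C := T * B ^ (β : ℝ))
    (w := fun x => Φ (chart β e x 0 t₀) 1 / x ^ (β : ℝ))
    (hest.mono fun x h => by rw [Real.dist_eq, sub_zero]; exact h.2.2)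
  have hlpos : 0 < e' * l :=
    hA.trans_le (ge_of_tendsto (hl.const_mul e') (hest.mono fun x h => h.1))
  have hl0 : 0 < |l| := abs_pos.2 (by rintro rfl; simp at hlpos)
  obtain ⟨H, A', B', hA', hB', hH, hHb⟩ :=
    exists_blowup hU (zero_lt_one.trans hβ1) he hΦ t₀
  -- After rescaling the image with weights `(1, β)`, the magnified displacement enters the first
  -- coordinate with the factor `x ^ (β - 1) → 0` and the second with factor `1`.
  have hlim : ∀ r t, MvPolynomial.eval ![l, ν + H r t 1] G = (height F e).eval t := by
    intro r t
    refine tendsto_nhds_unique_of_eventuallyEq (l := (U : Filter ℝ))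
      (f := fun x => MvPolynomial.eval ![Φ (chart β e x 0 t₀) 0 / x + x ^ ((β : ℝ) - 1) *
        ((x ^ (β : ℝ))⁻¹ • (Φ (chart β e x r t) - Φ (chart β e x 0 t₀))) 0,
        Φ (chart β e x 0 t₀) 1 / x ^ (β : ℝ) +
          ((x ^ (β : ℝ))⁻¹ • (Φ (chart β e x r t) - Φ (chart β e x 0 t₀))) 1] G)
      (((continuous_eval G).tendsto _).comp (tendsto_pi_nhds.2 fun i => ?_))
      ((tendsto_eval_chart hβ F e r t).mono_left hU) ?_
    · fin_cases i
      · have h1 := (((tendsto_rpow_zero (by linarith : (0 : ℝ) < β - 1)).mono_left hU).mul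
          (tendsto_pi_nhds.1 (hH r t) 0))
        simpa using hl.add h1
      · exact hν.add (tendsto_pi_nhds.1 (hH r t) 1)
    · filter_upwards [hx0, htr r t] with x hx0 hx
      have hxp := Real.rpow_pos_of_pos hx0 (β : ℝ)
      rw [eval_chart hF hx0] at hx
      apply mul_left_cancel₀ (Real.rpow_pos_of_pos hx0 d).ne'
      rw [← hx, ← hG.2 x hx0]
      congr 2
      ext i
      fin_cases i
      · simp [Real.rpow_sub_one hx0.ne']
        field_simp
        ring
      · simp
        field_simp
        ring
  have hlp := Real.rpow_pos_of_pos hl0 (β : ℝ)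
  have hld := Real.rpow_pos_of_pos hl0 d
  -- Presents `s ↦ G(l, ν + s)` as a one-variable polynomial, to which `biLip_component` applies.
  have hev : ∀ s, (Polynomial.C (|l| ^ d) * (height G e').comp (Polynomial.C (|l| ^ (β : ℝ))⁻¹ *
      (Polynomial.C ν + Polynomial.X))).eval s = MvPolynomial.eval ![l, ν + s] G := fun s => by
    rw [hG.eval_eq_height he' hlpos]
    simp [div_eq_inv_mul]
  obtain ⟨t₁, ht₁⟩ := exists_eval_ne_zero hf0
  have hτ := biLip_component hA' hB' hHb 1 (u := H 0 t₁ 1) (v := H 0 t₀ 1)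
    (by rw [hev, hev, hlim, hlim, ht₀]; exact ht₁)
    (fun r t => by rw [hev, hlim r t])
  refine .of_biLip hf0 (hG.height_ne_zero he0') (τ := fun t => (ν + H 0 t 1) / |l| ^ (β : ℝ))
    (div_pos hA' hlp) (div_pos hB' hlp) (fun s t => ?_) (inv_pos.2 hld) (fun t => ?_)
  · rw [← sub_div, add_sub_add_left_eq_sub, abs_div, abs_of_pos hlp, div_mul_eq_mul_div,
      div_mul_eq_mul_div, div_le_div_iff_of_pos_right hlp, div_le_div_iff_of_pos_right hlp]
    exact hτ s t
  · rw [← hlim 0 t, hG.eval_eq_height he' hlpos, inv_mul_cancel_left₀ hld.ne']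

end

/-! ### Branches mapped into the y-axis -/

section

variable {β : ℚ} {d : ℝ} {F G : MvPolynomial (Fin 2) ℝ} {Φ : (Fin 2 → ℝ) → (Fin 2 → ℝ)}

theorem IsQuasihomogeneous.exists_max_exponent (hG : IsQuasihomogeneous β d G) :
    ∃ m ∈ G.support, ∀ n ∈ G.support, n 1 ≤ m 1 := by
  obtain ⟨m, hm, h⟩ := G.support.exists_max_image (fun n => n 1)
    (MvPolynomial.support_nonempty.2 hG.1)
  exact ⟨m, hm, h⟩

/-- If the germ maps a zero branch of `F` into the `y`-axis then `F` and `G` are dominated by a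
power of `X * Y` and the height function of `F` is equivalent to a pure power. -/
theorem exists_of_exceptional (hβ : 1 < β) (hF : IsQuasihomogeneous β d F)
    (hG : IsQuasihomogeneous β d G) (hΦ : IsBiLipGerm Φ) (hT : Transforms Φ F G) {e : ℝ}
    (he : |e| = 1) {t₀ : ℝ} (ht₀ : (height F e).eval t₀ = 0)
    (hfr : ∃ᶠ x in 𝓝[>] 0, Φ (chart β e x 0 t₀) 0 = 0) :
    ∃ m ∈ G.support, m 0 = m 1 ∧ m 1 ≠ 0 ∧
      PolyLipEquiv (height F e) (Polynomial.C (G.coeff m) * Polynomial.X ^ m 1) := by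
  have hβ1 : (1 : ℝ) < β := by exact_mod_cast hβ
  have he0 : e ≠ 0 := by rintro rfl; simp at he
  have hf0 := hF.height_ne_zero he0
  obtain ⟨t₁, ht₁⟩ := exists_eval_ne_zero hf0
  obtain ⟨U, hU, hzero⟩ := exists_ultrafilter_of_frequently hfr
  have hx0 : ∀ᶠ x in (U : Filter ℝ), 0 < x := hU self_mem_nhdsWithin
  obtain ⟨A, B, hA, hB, hAB⟩ := hΦ.curve_bounds hβ1 he t₀
  have htr : ∀ r t, ∀ᶠ x in (U : Filter ℝ), MvPolynomial.eval (Φ (chart β e x r t)) G =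
      MvPolynomial.eval (chart β e x r t) F := fun r t =>
    ((tendsto_chart (by linarith) r t).mono_left hU).eventually hT
  have hest : ∀ᶠ x in (U : Filter ℝ), A ≤ |Φ (chart β e x 0 t₀) 1 / x| ∧
      |Φ (chart β e x 0 t₀) 1 / x| ≤ B := by
    filter_upwards [hx0, hU hAB, hzero] with x hx0 hab hz
    rw [hz, abs_zero, max_eq_right (abs_nonneg (Φ (chart β e x 0 t₀) 1))] at hab
    rw [abs_div, abs_of_pos hx0, le_div_iff₀ hx0, div_le_iff₀ hx0]
    exact hab
  obtain ⟨μ, hμ⟩ := Ultrafilter.exists_tendsto_of_bounded (a := (0 : ℝ)) (C := B)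
    (w := fun x => Φ (chart β e x 0 t₀) 1 / x)
    (hest.mono fun x h => by rw [Real.dist_eq, sub_zero]; exact h.2)
  have hμ0 : μ ≠ 0 :=
    abs_pos.1 (hA.trans_le (ge_of_tendsto hμ.abs (hest.mono fun x h => h.1)))
  obtain ⟨m, hm, hmax⟩ := hG.exists_max_exponent
  have hc := MvPolynomial.mem_support_iff.1 hm
  -- Otherwise the restriction of `G` to the y-axis is `c Y ^ (m 1)`; the image point, a zero of `G`
  -- on that axis, would be the origin, against the lower bound `A`.
  have hm0 : m 0 ≠ 0 := by
    intro hm0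
    obtain ⟨x, hx0, hab, hz, htr⟩ := (hx0.and (hest.and (hzero.and (htr 0 t₀)))).exists
    rw [eval_curve hF hx0, ht₀, mul_zero, eval_pair, hz,
      Finset.sum_eq_single_of_mem m hm, hm0, pow_zero, one_mul] at htr
    · have hv : Φ (chart β e x 0 t₀) 1 = 0 :=
        eq_zero_of_pow_eq_zero ((mul_eq_zero.1 htr).resolve_left hc)
      rw [hv, zero_div, abs_zero] at hab
      exact hA.not_ge hab.1
    · intro n hn hnm
      rw [zero_pow, zero_mul, mul_zero]
      intro hn0
      have h1 := hG.exponent_eq hm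
      have h2 := hG.exponent_eq hn
      rw [hm0, ← h2, hn0, add_right_inj] at h1
      exact hnm (hG.eq_of_apply_one_eq hn hm
        (by exact_mod_cast (mul_left_cancel₀ (by linarith) h1).symm))
  obtain ⟨H, A', B', hA', hB', hH, hHb⟩ :=
    exists_blowup hU (zero_lt_one.trans hβ1) he hΦ t₀
  -- Here the first coordinate has size `x ^ β` and the second size `x`, so the monomial `n` has
  -- order `β * n 0 + n 1`. Since `n 0 + β * n 1 = d`, its excess over the order of `m` is `(β ^ 2 -
  -- 1) * (m 1 - n 1)`: only the monomial of maximal `Y`-degree survives.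
  have hsum : ∀ r t, Tendsto (fun x : ℝ => ∑ n ∈ G.support, G.coeff n *
      (x ^ (((β : ℝ) ^ 2 - 1) * ((m 1 : ℝ) - n 1)) *
        (((x ^ (β : ℝ))⁻¹ • (Φ (chart β e x r t) - Φ (chart β e x 0 t₀))) 0 ^ n 0 *
        (Φ (chart β e x 0 t₀) 1 / x + x ^ ((β : ℝ) - 1) *
          ((x ^ (β : ℝ))⁻¹ • (Φ (chart β e x r t) - Φ (chart β e x 0 t₀))) 1) ^ n 1))) U
      (𝓝 (G.coeff m * (H r t 0 ^ m 0 * μ ^ m 1))) := by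
    intro r t
    rw [← Finset.sum_ite_eq' G.support m
      (fun n => G.coeff n * (H r t 0 ^ n 0 * μ ^ n 1)) |>.trans (if_pos hm)]
    refine tendsto_finsetSum _ fun n hn => ?_
    have h1 : Tendsto (fun x : ℝ =>
        (((x ^ (β : ℝ))⁻¹ • (Φ (chart β e x r t) - Φ (chart β e x 0 t₀))) 0 ^ n 0 *
        (Φ (chart β e x 0 t₀) 1 / x + x ^ ((β : ℝ) - 1) *
          ((x ^ (β : ℝ))⁻¹ • (Φ (chart β e x r t) - Φ (chart β e x 0 t₀))) 1) ^ n 1)) U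
        (𝓝 (H r t 0 ^ n 0 * μ ^ n 1)) := by
      have h2 := ((tendsto_rpow_zero (by linarith : (0 : ℝ) < β - 1)).mono_left hU).mul
        (tendsto_pi_nhds.1 (hH r t) 1)
      have h3 := (hμ.add h2).pow (n 1)
      rw [zero_mul, add_zero] at h3
      exact ((tendsto_pi_nhds.1 (hH r t) 0).pow (n 0)).mul h3
    split_ifs with hnm
    · subst hnm
      simpa using h1.const_mul (G.coeff n)
    · have h4 : (n 1 : ℝ) < m 1 := by
        exact_mod_cast lt_of_le_of_ne (hmax n hn) fun h => hnm (hG.eq_of_apply_one_eq hn hm h)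
      have h5 := (((tendsto_rpow_zero (mul_pos (by nlinarith : (0 : ℝ) < (β : ℝ) ^ 2 - 1)
        (sub_pos.2 h4))).mono_left hU).mul h1).const_mul (G.coeff n)
      simpa using h5
  have hid : ∀ r t, ∀ᶠ x : ℝ in (U : Filter ℝ), x ^ (d - (β * m 0 + m 1)) *
      MvPolynomial.eval ![e * (1 + x ^ ((β : ℝ) - 1) * r), t] F = ∑ n ∈ G.support, G.coeff n *
      (x ^ (((β : ℝ) ^ 2 - 1) * ((m 1 : ℝ) - n 1)) *
        (((x ^ (β : ℝ))⁻¹ • (Φ (chart β e x r t) - Φ (chart β e x 0 t₀))) 0 ^ n 0 *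
        (Φ (chart β e x 0 t₀) 1 / x + x ^ ((β : ℝ) - 1) *
          ((x ^ (β : ℝ))⁻¹ • (Φ (chart β e x r t) - Φ (chart β e x 0 t₀))) 1) ^ n 1)) := by
    intro r t
    filter_upwards [hx0, hzero, htr r t] with x hx0 hz hx
    have hxp := Real.rpow_pos_of_pos hx0 (β : ℝ)
    rw [eval_chart hF hx0] at hx
    rw [Real.rpow_sub hx0, div_mul_eq_mul_div, ← hx,
      div_eq_iff (Real.rpow_pos_of_pos hx0 _).ne', eval_pair, Finset.sum_mul]
    refine Finset.sum_congr rfl fun n hn => ?_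
    have h0 : Φ (chart β e x r t) 0 = x ^ (β : ℝ) *
        ((x ^ (β : ℝ))⁻¹ • (Φ (chart β e x r t) - Φ (chart β e x 0 t₀))) 0 := by
      simp [hz, mul_inv_cancel_left₀ hxp.ne']
    have h1 : Φ (chart β e x r t) 1 = x * (Φ (chart β e x 0 t₀) 1 / x + x ^ ((β : ℝ) - 1) *
          ((x ^ (β : ℝ))⁻¹ • (Φ (chart β e x r t) - Φ (chart β e x 0 t₀))) 1) := by
      simp [Real.rpow_sub_one hx0.ne']
      field_simp
      ring
    have h2 : (x ^ (β : ℝ)) ^ n 0 * x ^ n 1 =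
        x ^ (((β : ℝ) ^ 2 - 1) * ((m 1 : ℝ) - n 1)) * x ^ ((β : ℝ) * m 0 + m 1) := by
      rw [← Real.rpow_natCast, ← Real.rpow_natCast, ← Real.rpow_mul hx0.le,
        ← Real.rpow_add hx0, ← Real.rpow_add hx0]
      congr 1
      have h3 := hG.exponent_eq hm
      rw [← hG.exponent_eq hn] at h3
      have h4 : (n 0 : ℝ) = m 0 + β * m 1 - β * n 1 := by linarith
      rw [h4]
      ring
    rw [h0, h1, mul_pow, mul_pow]
    generalize ((x ^ (β : ℝ))⁻¹ • (Φ (chart β e x r t) - Φ (chart β e x 0 t₀))) = w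
    linear_combination (G.coeff n * (w 0 ^ n 0 *
      (Φ (chart β e x 0 t₀) 1 / x + x ^ ((β : ℝ) - 1) * w 1) ^ n 1)) * h2
  have hFlim : ∀ r t, Tendsto
      (fun x : ℝ => MvPolynomial.eval ![e * (1 + x ^ ((β : ℝ) - 1) * r), t] F) U
      (𝓝 ((height F e).eval t)) := fun r t => (tendsto_eval_chart hβ F e r t).mono_left hU
  -- Both sides must have the same order: if `d` were smaller, `F(e, t₁)` would vanish; if larger,
  -- the first component of `H` would vanish identically.
  have hd : d = β * m 0 + m 1 := by
    rcases lt_trichotomy d (β * m 0 + m 1) with h | h | h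
    · exfalso
      refine ht₁ (tendsto_nhds_unique_of_eventuallyEq (hFlim 0 t₁)
        ((((tendsto_rpow_zero (sub_pos.2 h)).mono_left hU).mul (hsum 0 t₁)).trans
          (by rw [zero_mul])) ?_)
      filter_upwards [hx0, hid 0 t₁] with x hx0 hx
      rw [← hx, ← mul_assoc, ← Real.rpow_add hx0, sub_add_sub_cancel, sub_self,
        Real.rpow_zero, one_mul]
    · exact h
    · exfalso
      have h0 : ∀ r t, H r t 0 = 0 := by
        intro r t
        have h1 := tendsto_nhds_unique_of_eventuallyEq (hsum r t)
          (((tendsto_rpow_zero (sub_pos.2 h)).mono_left hU).mul (hFlim r t))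
          ((hid r t).mono fun x hx => hx.symm)
        rw [zero_mul] at h1
        have h2 := ((mul_eq_zero.1 h1).resolve_left hc)
        exact eq_zero_of_pow_eq_zero ((mul_eq_zero.1 h2).resolve_right (pow_ne_zero _ hμ0))
      have := (biLip_component hA' hB' hHb 0 (P := Polynomial.X) (u := 0) (v := 1) (by simp)
        (f := fun _ => 0) (fun r t => by simp [h0 r t]) 0 1).1
      simp only [h0] at this
      norm_num at this
      linarith
  have hlim : ∀ r t, G.coeff m * (H r t 0 ^ m 0 * μ ^ m 1) = (height F e).eval t := by
    intro r t
    refine tendsto_nhds_unique_of_eventuallyEq (hsum r t) (hFlim r t) ?_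
    filter_upwards [hid r t] with x hx
    rw [← hx, hd, sub_self, Real.rpow_zero, one_mul]
  -- Combines `d = β * m 0 + m 1` with the weight relation `d = m 0 + β * m 1`, using `β ≠ 1`.
  have hmm : m 0 = m 1 := by
    have h1 := hG.exponent_eq hm
    rw [hd] at h1
    have h2 : ((β : ℝ) - 1) * ((m 0 : ℝ) - m 1) = 0 := by linarith
    exact_mod_cast sub_eq_zero.1 ((mul_eq_zero.1 h2).resolve_left (by linarith))
  refine ⟨m, hm, hmm, hmm ▸ hm0, ?_⟩
  have hτ := biLip_component hA' hB' hHb 0 (u := H 0 t₁ 0) (v := H 0 t₀ 0)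
    (P := Polynomial.C (G.coeff m * μ ^ m 1) * Polynomial.X ^ m 0)
    (f := fun t => (height F e).eval t)
    (by
      have h1 := hlim 0 t₁
      have h2 := hlim 0 t₀
      rw [ht₀] at h2
      simp only [Polynomial.eval_mul, Polynomial.eval_C, Polynomial.eval_pow, Polynomial.eval_X]
      intro h
      exact ht₁ (by linarith))
    (fun r t => by simp only [← hlim r t, Polynomial.eval_mul, Polynomial.eval_C,
      Polynomial.eval_pow, Polynomial.eval_X]; ring)
  have hμa := abs_pos.2 hμ0
  refine .of_biLip hf0 (by simpa using hc) (τ := fun t => μ * H 0 t 0) (mul_pos hμa hA')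
    (mul_pos hμa hB') (fun s t => ?_) one_pos (fun t => ?_)
  · rw [← mul_sub, abs_mul, mul_assoc, mul_assoc]
    exact ⟨mul_le_mul_of_nonneg_left (hτ s t).1 hμa.le,
      mul_le_mul_of_nonneg_left (hτ s t).2 hμa.le⟩
  · rw [one_mul, ← hlim 0 t, hmm]
    simp only [Polynomial.eval_mul, Polynomial.eval_C, Polynomial.eval_pow, Polynomial.eval_X]
    ring

end

/-! ### Polynomials equivalent to a pure power -/

theorem eq_C_of_bounded {h : Polynomial ℝ} {K : ℝ} (hK : ∀ s, |h.eval s| ≤ K) :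
    ∃ a, h = Polynomial.C a :=
  ⟨_, Polynomial.eq_C_of_degree_le_zero ((Polynomial.isBoundedUnder_abs_atTop_iff h).1
    (isBoundedUnder_of ⟨K, hK⟩))⟩

theorem eq_C_mul_X_pow_of_bound {K : ℝ} {k : ℕ} {h : Polynomial ℝ}
    (hK : ∀ s, |h.eval s| ≤ K * |s| ^ k) : ∃ a, h = Polynomial.C a * Polynomial.X ^ k := by
  induction k generalizing h with
  | zero => simpa using eq_C_of_bounded (h := h) (K := K) (by simpa using hK)
  | succ k ih =>
    have h0 : h.eval 0 = 0 := by simpa using hK 0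
    obtain ⟨q, rfl⟩ := Polynomial.X_dvd_iff.2 ((Polynomial.coeff_zero_eq_eval_zero h).trans h0)
    -- The bound for the quotient by `X` is known off `0` and extends to `0` by continuity.
    have hclosed : IsClosed {s : ℝ | |q.eval s| ≤ K * |s| ^ k} :=
      isClosed_le (by fun_prop) (by fun_prop)
    have hsub : ({0}ᶜ : Set ℝ) ⊆ {s : ℝ | |q.eval s| ≤ K * |s| ^ k} := by
      intro s hs
      have h1 := hK s
      rw [Polynomial.eval_mul, Polynomial.eval_X, abs_mul, pow_succ, ← mul_assoc,
        mul_comm (|s|)] at h1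
      exact le_of_mul_le_mul_right h1 (abs_pos.2 hs)
    obtain ⟨a, ha⟩ := ih fun s => hclosed.closure_subset_iff.2 hsub (dense_compl_singleton 0 s)
    exact ⟨a, by rw [ha, pow_succ]; ring⟩

/-- Around the zero `φ.symm 0`, the Lipschitz bound gives `|f| ≤ K |s| ^ k` on the whole line, which
leaves room only for a monomial in `s`. -/
theorem PolyLipEquiv.eq_of_pow {f : Polynomial ℝ} {c : ℝ} {k : ℕ}
    (h : PolyLipEquiv f (Polynomial.C c * Polynomial.X ^ k)) :
    ∃ a t₀, f = Polynomial.C a * (Polynomial.X - Polynomial.C t₀) ^ k ∧ a ≠ 0 ∧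
      (Even k → 0 < a * c) := by
  obtain ⟨hf, hg, φ, ⟨A, B, hA, hB, hφ⟩, κ, hκ, h⟩ := h
  simp only [Polynomial.eval_mul, Polynomial.eval_C, Polynomial.eval_pow,
    Polynomial.eval_X] at h
  have hc : c ≠ 0 := by rintro rfl; simp at hg
  obtain ⟨a, ha⟩ := eq_C_mul_X_pow_of_bound (K := |c| * B ^ k / κ) (k := k)
    (h := f.comp (Polynomial.X + Polynomial.C (φ.symm 0))) fun s => by
      have h1 := (hφ (s + φ.symm 0) (φ.symm 0)).2
      rw [φ.apply_symm_apply, sub_zero, add_sub_cancel_right] at h1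
      have h2 := congrArg abs (h (s + φ.symm 0))
      rw [abs_mul, abs_mul, abs_pow, abs_of_pos hκ] at h2
      simp only [Polynomial.eval_comp, Polynomial.eval_add, Polynomial.eval_X, Polynomial.eval_C]
      rw [div_mul_eq_mul_div, le_div_iff₀ hκ, mul_comm, ← h2, mul_assoc, ← mul_pow]
      exact mul_le_mul_of_nonneg_left (pow_le_pow_left₀ (abs_nonneg _) h1 k) (abs_nonneg c)
  have hfa : f = Polynomial.C a * (Polynomial.X - Polynomial.C (φ.symm 0)) ^ k := by
    have := congrArg (fun p => Polynomial.comp p (Polynomial.X - Polynomial.C (φ.symm 0))) ha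
    simpa [Polynomial.comp_assoc] using this
  have ha0 : a ≠ 0 := by rintro rfl; simp [hfa] at hf
  refine ⟨a, φ.symm 0, hfa, ha0, fun hk => lt_of_le_of_ne ?_ (mul_ne_zero ha0 hc).symm⟩
  have h1 := h (φ.symm 0 + 1)
  rw [hfa] at h1
  simp only [Polynomial.eval_mul, Polynomial.eval_C, Polynomial.eval_pow, Polynomial.eval_sub,
    Polynomial.eval_X, add_sub_cancel_left, one_pow, mul_one] at h1
  refine nonneg_of_mul_nonneg_right (a := κ) ?_ hκ
  rw [← mul_assoc, ← h1, mul_right_comm]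
  exact mul_nonneg (mul_self_nonneg c) (hk.pow_nonneg _)

/-- For odd `k` a negative ratio is absorbed by `t ↦ -t`; for even `k` the sign is an invariant. -/
theorem polyLipEquiv_pow_pow {a c : ℝ} {k : ℕ} (ha : a ≠ 0) (hc : c ≠ 0)
    (h : Even k → 0 < a * c) :
    PolyLipEquiv (Polynomial.C a * Polynomial.X ^ k) (Polynomial.C c * Polynomial.X ^ k) := by
  rcases Nat.even_or_odd k with hk | hk
  · refine .of_smul (a := 1) (c := c / a) (by simpa) (by simpa) one_ne_zero ?_ fun t => ?_
    · have := h hk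
      rw [← mul_div_mul_left c a ha, mul_comm a c, mul_comm c a]
      exact div_pos this (mul_self_pos.2 ha)
    · simp
      field_simp
  · rcases lt_or_gt_of_ne (mul_ne_zero ha hc) with hac | hac
    · refine .of_smul (a := -1) (c := -(c / a)) (by simpa) (by simpa) (by norm_num) ?_ fun t => ?_
      · rw [← mul_div_mul_left c a ha, neg_pos]
        exact div_neg_of_neg_of_pos hac (mul_self_pos.2 ha)
      · simp [hk.neg_pow]
        field_simp
    · refine .of_smul (a := 1) (c := c / a) (by simpa) (by simpa) one_ne_zero ?_ fun t => ?_
      · rw [← mul_div_mul_left c a ha]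
        exact div_pos hac (mul_self_pos.2 ha)
      · simp
        field_simp

theorem PolyLipEquiv.const_mul {f g : Polynomial ℝ} (h : PolyLipEquiv f g) {a : ℝ} (ha : a ≠ 0) :
    PolyLipEquiv (Polynomial.C a * f) (Polynomial.C a * g) := by
  obtain ⟨hf, hg, φ, hφ, κ, hκ, h⟩ := h
  refine ⟨by simp [ha, hf], by simp [ha, hg], φ, hφ, κ, hκ, fun t => ?_⟩
  simp [h, mul_left_comm]

/-! ### Rigidity when a height function is a pure power up to equivalence -/

section

variable {β : ℚ} {d : ℝ} {F G : MvPolynomial (Fin 2) ℝ} {Φ : (Fin 2 → ℝ) → (Fin 2 → ℝ)}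

/-- The height function is `a (X - t₀) ^ k`, so its coefficients are known explicitly. If `t₀ ≠ 0`
all binomial terms occur, which forces `β` to be an integer; if `t₀ = 0` there is a single monomial.
Either way `F` has a reflection symmetry, up to sign, that exchanges the half-planes. -/
theorem exists_of_height_equiv_pow (hβ : 1 < β) (hF : IsQuasihomogeneous β d F) {e : ℝ}
    (he : |e| = 1) {k : ℕ} (hk : k ≠ 0) (hd : (k : ℝ) + β * k = d) {c : ℝ}
    (h : PolyLipEquiv (height F e) (Polynomial.C c * Polynomial.X ^ k)) :
    (∃ m ∈ F.support, m 0 = k ∧ m 1 = k ∧ (Even k → 0 < F.coeff m * c)) ∧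
      (∀ n ∈ F.support, n 1 ≤ k) ∧
      PolyLipEquiv (height F (-e)) (Polynomial.C c * Polynomial.X ^ k) := by
  have hβ1 : (1 : ℝ) < β := by exact_mod_cast hβ
  have he0 : e ≠ 0 := by rintro rfl; simp at he
  obtain ⟨a, t₀, hfa, ha, hac⟩ := h.eq_of_pow
  have hcoeff : ∀ j, (height F e).coeff j = a * ((-t₀) ^ (k - j) * (k.choose j : ℝ)) := by
    intro j
    rw [hfa, Polynomial.coeff_C_mul, sub_eq_add_neg, ← Polynomial.C_neg,
      Polynomial.coeff_X_add_C_pow]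
  have hne : ∀ n ∈ F.support, (height F e).coeff (n 1) ≠ 0 := fun n hn => by
    rw [hF.coeff_height hn]
    exact mul_ne_zero (MvPolynomial.mem_support_iff.1 hn) (pow_ne_zero _ he0)
  have hle : ∀ n ∈ F.support, n 1 ≤ k := by
    intro n hn
    by_contra! hlt
    exact hne n hn (by rw [hcoeff, Nat.choose_eq_zero_of_lt hlt]; simp)
  have hmem : ∃ m ∈ F.support, m 0 = k ∧ m 1 = k := by
    obtain ⟨m, hm, hmk⟩ := IsQuasihomogeneous.exists_of_coeff_height_ne_zero (F := F) (e := e) (n := k)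
      (by rw [hcoeff]; simpa using ha)
    refine ⟨m, hm, ?_, hmk⟩
    have := hF.exponent_eq hm
    rw [← hd, hmk] at this
    exact_mod_cast add_right_cancel this
  -- The witness is `N = β` when `t₀ ≠ 0`, read off from the monomial with `Y`-exponent `k - 1`.
  -- When `t₀ = 0` any `N` would do, and `0` is taken.
  have hN : ∃ N : ℕ, ∀ n ∈ F.support, n 0 + N * n 1 = k + N * k := by
    by_cases ht₀ : t₀ = 0
    · refine ⟨0, fun n hn => ?_⟩
      have h1 := hne n hn
      rw [hcoeff, ht₀, neg_zero] at h1
      have h2 : n 1 = k := by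
        by_contra hne'
        have := lt_of_le_of_ne (hle n hn) hne'
        exact h1 (by rw [zero_pow (by omega)]; simp)
      have h3 := hF.exponent_eq hn
      rw [← hd, h2] at h3
      have h4 : (n 0 : ℝ) = k := add_right_cancel h3
      have h5 : n 0 = k := by exact_mod_cast h4
      simp [h5]
    · obtain ⟨m, hm, hmk⟩ := IsQuasihomogeneous.exists_of_coeff_height_ne_zero (F := F) (e := e) (n := k - 1) (by
        rw [hcoeff]
        refine mul_ne_zero ha (mul_ne_zero (pow_ne_zero _ (neg_ne_zero.2 ht₀)) ?_)
        exact_mod_cast (Nat.choose_pos (Nat.sub_le k 1)).ne')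
      have h1 := hF.exponent_eq hm
      rw [hmk, Nat.cast_sub (Nat.one_le_iff_ne_zero.2 hk), Nat.cast_one, ← hd] at h1
      have h2 : (m 0 : ℝ) = k + β := by linarith
      have h3 : k ≤ m 0 := by
        have : (k : ℝ) ≤ m 0 := by linarith
        exact_mod_cast this
      refine ⟨m 0 - k, fun n hn => ?_⟩
      have h4 := hF.exponent_eq hn
      have h5 : (β : ℝ) = ((m 0 - k : ℕ) : ℝ) := by rw [Nat.cast_sub h3]; linarith
      rw [← hd, h5] at h4
      exact_mod_cast h4
  refine ⟨?_, hle, ?_⟩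
  · obtain ⟨m, hm, hm0, hm1⟩ := hmem
    refine ⟨m, hm, hm0, hm1, fun hk => ?_⟩
    have h1 := hF.coeff_height hm e
    rw [hm1, hcoeff, hm0, ← hk.pow_abs, he] at h1
    simp only [tsub_self, pow_zero, Nat.choose_self, Nat.cast_one, mul_one, one_pow] at h1
    rw [← h1]
    exact hac hk
  · obtain ⟨N, hN⟩ := hN
    have hc : c ≠ 0 := by
      have := h.2.1
      rintro rfl
      simp at this
    have hsym : ∀ t, (height F (-e)).eval ((-1) ^ N * t) =
        ((-1) ^ (N + 1)) ^ k * (height F e).eval t := by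
      intro t
      rw [eval_height, eval_height, eval_pair, eval_pair, Finset.mul_sum]
      refine Finset.sum_congr rfl fun n hn => ?_
      have h1 : (-1 : ℝ) ^ n 0 * ((-1) ^ N) ^ n 1 = ((-1) ^ (N + 1)) ^ k := by
        rw [← pow_mul, ← pow_add, hN n hn, ← pow_mul]
        congr 1
        ring
      simp only [Matrix.cons_val_zero, Matrix.cons_val_one, Matrix.cons_val_fin_one]
      rw [← h1, neg_pow e, mul_pow]
      ring
    have hpos : ((-1 : ℝ) ^ (N + 1)) ^ k ≠ 0 := pow_ne_zero _ (pow_ne_zero _ (by norm_num))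
    have h1 : PolyLipEquiv (Polynomial.C (((-1) ^ (N + 1)) ^ k) * height F e) (height F (-e)) :=
      .of_smul (a := (-1) ^ N) (c := 1)
        (mul_ne_zero (Polynomial.C_ne_zero.2 hpos) (hF.height_ne_zero he0))
        (hF.height_ne_zero (neg_ne_zero.2 he0)) (pow_ne_zero _ (by norm_num)) one_pos
        fun t => by rw [hsym, one_mul, Polynomial.eval_mul, Polynomial.eval_C]
    -- The sign produced by the symmetry is a `k`-th power, so a reflection of the variable absorbs
    -- it into `X ^ k`.
    have h2 : PolyLipEquiv (Polynomial.C (((-1) ^ (N + 1)) ^ k) *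
        (Polynomial.C c * Polynomial.X ^ k)) (Polynomial.C c * Polynomial.X ^ k) :=
      .of_smul (a := (-1) ^ (N + 1)) (c := 1)
        (mul_ne_zero (Polynomial.C_ne_zero.2 hpos) (by simpa using hc)) (by simpa using hc)
        (pow_ne_zero _ (by norm_num)) one_pos fun t => by
          simp only [Polynomial.eval_mul, Polynomial.eval_C, Polynomial.eval_pow,
            Polynomial.eval_X, mul_pow]
          ring
    exact h1.symm.trans ((h.const_mul hpos).trans h2)

end

/-! ### Existence and separation of branches -/

section

variable {β : ℚ} {d : ℝ} {F G : MvPolynomial (Fin 2) ℝ} {Φ Ψ : (Fin 2 → ℝ) → (Fin 2 → ℝ)}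

/-- A polynomial dominated by a power of `X * Y` is transformed only into polynomials that vanish
somewhere in each open half-plane. -/
theorem exists_zero_height (hβ : 1 < β) (hF : IsQuasihomogeneous β d F)
    (hG : IsQuasihomogeneous β d G) (hΦ : IsBiLipGerm Φ) (hΨ : IsBiLipGerm Ψ)
    (hΦΨ : ∀ᶠ q in 𝓝 0, Φ (Ψ q) = q) (hT : Transforms Φ F G)
    (hzero : ∀ e : ℝ, |e| = 1 → ∃ t, (height F e).eval t = 0)
    {m : Fin 2 →₀ ℕ} (hm : m ∈ F.support) (hm01 : m 0 = m 1) (hm0 : m 1 ≠ 0)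
    (hmax : ∀ n ∈ F.support, n 1 ≤ m 1) {e' : ℝ} (he' : |e'| = 1) :
    ∃ t, (height G e').eval t = 0 := by
  have hβ1 : (1 : ℝ) < β := by exact_mod_cast hβ
  have hβ0 : (0 : ℝ) < β := by linarith
  have hc := MvPolynomial.mem_support_iff.1 hm
  have hd := hF.exponent_eq hm
  rw [hm01] at hd
  have hk1 : (1 : ℝ) ≤ m 1 := by exact_mod_cast Nat.one_le_iff_ne_zero.2 hm0
  set U : Ultrafilter ℝ := Ultrafilter.of (𝓝[>] 0)
  have hU : (U : Filter ℝ) ≤ 𝓝[>] 0 := Ultrafilter.of_le _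
  have hx0 : ∀ᶠ x in (U : Filter ℝ), 0 < x := hU self_mem_nhdsWithin
  obtain ⟨A, B, -, -, hAB⟩ := hΨ.curve_bounds hβ1 he' 0
  set p : ℝ → Fin 2 → ℝ := fun x => Ψ (chart β e' x 0 0)
  have hq : Tendsto (fun x => chart β e' x 0 0) U (𝓝 0) := (tendsto_chart hβ0 0 0).mono_left hU
  have hp0 : Tendsto p U (𝓝 0) := hΨ.continuousAt.comp hq
  have hest : ∀ᶠ x in (U : Filter ℝ), |p x 0 / x| ≤ B ∧ |p x 1 / x| ≤ B := by
    filter_upwards [hx0, hU hAB] with x hx0 hab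
    simp only [abs_div, abs_of_pos hx0]
    rw [div_le_iff₀ hx0, div_le_iff₀ hx0]
    exact ⟨(le_max_left _ _).trans hab.2, (le_max_right _ _).trans hab.2⟩
  obtain ⟨a, ha⟩ := Ultrafilter.exists_tendsto_of_bounded (a := (0 : ℝ)) (C := B)
    (w := fun x => p x 0 / x) (hest.mono fun x h => by rw [Real.dist_eq, sub_zero]; exact h.1)
  obtain ⟨b, hb⟩ := Ultrafilter.exists_tendsto_of_bounded (a := (0 : ℝ)) (C := B)
    (w := fun x => p x 1 / x) (hest.mono fun x h => by rw [Real.dist_eq, sub_zero]; exact h.2)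
  -- zeros of `F` close to `p` are mapped to zeros of `G` close to the `x`-axis
  have key : ∀ z : ℝ → Fin 2 → ℝ, (∀ᶠ x in (U : Filter ℝ), MvPolynomial.eval (z x) F = 0) →
      Tendsto (fun x => dist (z x) (p x) / x) U (𝓝 0) → ∃ t, (height G e').eval t = 0 := by
    intro z hz hzp
    have hz0 : Tendsto z U (𝓝 0) := by
      refine (tendsto_iff_of_dist ?_).2 hp0
      have h1 := hzp.mul (tendsto_id.mono_left (hU.trans nhdsWithin_le_nhds))
      rw [zero_mul] at h1
      refine h1.congr' ?_
      filter_upwards [hx0] with x hx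
      simp [hx.ne']
    obtain ⟨-, A', B', hA', hB', S, hS, hΦS⟩ := hΦ
    obtain ⟨x, hx, hzS, hpS, hTz, hFz, hqx, hsmall⟩ := (hx0.and ((hz0.eventually_mem hS).and
      ((hp0.eventually_mem hS).and ((hz0.eventually hT).and (hz.and ((hq.eventually hΦΨ).and
      ((hzp.const_mul B').eventually_lt_const (by rw [mul_zero]; exact one_pos)))))))).exists
    have h1 := (hΦS _ hzS _ hpS).2
    have h2 : Φ (p x) = chart β e' x 0 0 := hqx
    rw [← mul_div_assoc, div_lt_one hx] at hsmall
    have h3 : |Φ (z x) 0 - e' * x| < x := by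
      have := abs_sub_le_dist (Φ (z x)) (Φ (p x)) 0
      rw [h2] at this h1
      simp only [chart, mul_zero, add_zero, Matrix.cons_val_zero] at this h1
      linarith
    have h4 : 0 < e' * Φ (z x) 0 := by
      rcases eq_or_eq_neg_of_abs_eq he' with rfl | rfl
      · linarith [(abs_lt.1 h3).1]
      · linarith [(abs_lt.1 h3).2]
    have h5 : ![Φ (z x) 0, Φ (z x) 1] = Φ (z x) := by ext i; fin_cases i <;> rfl
    rw [hFz, ← h5, hG.eval_eq_height he' h4] at hTz
    have hne : |Φ (z x) 0| ≠ 0 := by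
      intro h
      rw [abs_eq_zero.1 h] at h4
      simp at h4
    exact ⟨_, (mul_eq_zero.1 hTz).resolve_left
      (Real.rpow_pos_of_pos (lt_of_le_of_ne (abs_nonneg _) hne.symm) _).ne'⟩
  -- At scale `x`, `F(p)` is `x ^ (2k)` times a quantity tending to `c (a b) ^ k`, where `k = m 1`;
  -- but `F(p) = G(e' x, 0)` is `O(x ^ d)` with `d = k + β k > 2k`.
  have hprod : a * b = 0 := by
    have hsum : Tendsto (fun x : ℝ => ∑ n ∈ F.support, F.coeff n *
        (x ^ (((β : ℝ) - 1) * ((m 1 : ℝ) - n 1)) * ((p x 0 / x) ^ n 0 * (p x 1 / x) ^ n 1))) U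
        (𝓝 (F.coeff m * (a ^ m 0 * b ^ m 1))) := by
      rw [← Finset.sum_ite_eq' F.support m
        (fun n => F.coeff n * (a ^ n 0 * b ^ n 1)) |>.trans (if_pos hm)]
      refine tendsto_finsetSum _ fun n hn => ?_
      have h1 := (ha.pow (n 0)).mul (hb.pow (n 1))
      split_ifs with hnm
      · subst hnm
        simpa using h1.const_mul (F.coeff n)
      · have h4 : (n 1 : ℝ) < m 1 := by
          exact_mod_cast lt_of_le_of_ne (hmax n hn) fun h => hnm (hF.eq_of_apply_one_eq hn hm h)
        have h5 := (((tendsto_rpow_zero (mul_pos (sub_pos.2 hβ1)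
          (sub_pos.2 h4))).mono_left hU).mul h1).const_mul (F.coeff n)
        simpa using h5
    have hlim : Tendsto (fun x : ℝ => x ^ (d - 2 * m 1) * (height G e').eval 0) U (𝓝 0) := by
      simpa using ((tendsto_rpow_zero (by nlinarith : 0 < d - 2 * m 1)).mono_left hU).mul_const
        ((height G e').eval 0)
    have h0 := tendsto_nhds_unique_of_eventuallyEq hsum hlim (by
      filter_upwards [hx0, (hT.inverse hΨ hΦΨ) |> hq.eventually] with x hx hTx
      rw [eval_curve hG hx, eval_pair] at hTx
      rw [Real.rpow_sub hx, div_mul_eq_mul_div, ← hTx,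
        eq_div_iff (Real.rpow_pos_of_pos hx _).ne', Finset.sum_mul]
      refine Finset.sum_congr rfl fun n hn => ?_
      have h2 : x ^ n 0 * x ^ n 1 =
          x ^ (((β : ℝ) - 1) * ((m 1 : ℝ) - n 1)) * x ^ (2 * (m 1 : ℝ)) := by
        rw [← Real.rpow_natCast, ← Real.rpow_natCast, ← Real.rpow_add hx, ← Real.rpow_add hx]
        congr 1
        have h4 : (n 0 : ℝ) = m 1 + β * m 1 - β * n 1 := by linarith [hF.exponent_eq hn]
        rw [h4]
        ring
      change _ = F.coeff n * (p x 0 ^ n 0 * p x 1 ^ n 1)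
      rw [mul_assoc, mul_right_comm, ← h2, div_pow, div_pow]
      field_simp)
    have h1 := (mul_eq_zero.1 h0).resolve_left hc
    rw [hm01, ← mul_pow] at h1
    exact eq_zero_of_pow_eq_zero h1
  -- If `a = 0`, then `p` is `o(x)`-close to the y-axis, on which `F` vanishes because every
  -- monomial of `F` contains `X`. If `a ≠ 0`, then `b = 0` and `p` is `o(x)`-close to a zero branch
  -- of `F` in the half-plane of the sign of `a`.
  by_cases ha0 : a = 0
  · refine key (fun x => ![0, p x 1]) (Eventually.of_forall fun x => ?_) ?_
    · rw [eval_pair]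
      refine Finset.sum_eq_zero fun n hn => ?_
      have : n 0 ≠ 0 := by
        intro h
        have h1 := hF.exponent_eq hn
        have h2 : (n 1 : ℝ) ≤ m 1 := by exact_mod_cast hmax n hn
        rw [h, Nat.cast_zero] at h1
        nlinarith
      simp [this]
    · have h1 := ha.abs
      rw [ha0, abs_zero] at h1
      refine h1.congr' ?_
      filter_upwards [hx0] with x hx
      rw [dist_fin_two, abs_div, abs_of_pos hx]
      simp
  · have hb0 : b = 0 := (mul_eq_zero.1 hprod).resolve_left ha0
    obtain ⟨e, he, hea⟩ : ∃ e : ℝ, |e| = 1 ∧ 0 < e * a := by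
      rcases lt_or_gt_of_ne ha0 with h | h
      · exact ⟨-1, by simp, by linarith⟩
      · exact ⟨1, by simp, by linarith⟩
    obtain ⟨t, ht⟩ := hzero e he
    have hpos : ∀ᶠ x in (U : Filter ℝ), 0 < e * p x 0 := by
      filter_upwards [hx0, (ha.const_mul e).eventually_const_lt hea] with x hx h
      rw [← mul_div_assoc] at h
      exact (div_pos_iff_of_pos_right hx).1 h
    refine key (fun x => chart β e (e * p x 0) 0 t) ?_ ?_
    · filter_upwards [hpos] with x hx
      rw [eval_curve hF hx, ht, mul_zero]
    · have h1 : Tendsto (fun x => |(e * (p x 0 / x)) ^ (β : ℝ) * x ^ ((β : ℝ) - 1) * t - p x 1 / x|)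
          U (𝓝 0) := by
        have h2 := ((((ha.const_mul e).rpow_const (p := (β : ℝ)) (Or.inr hβ0.le)).mul
          ((tendsto_rpow_zero (sub_pos.2 hβ1)).mono_left hU)).mul_const t).sub hb |>.abs
        simpa [hb0] using h2
      refine h1.congr' ?_
      filter_upwards [hx0, hpos] with x hx hpx
      have hee : e * e = 1 := by rw [← abs_mul_abs_self, he, one_mul]
      rw [dist_fin_two]
      simp only [chart, mul_zero, add_zero, Matrix.cons_val_zero, Matrix.cons_val_one,
        Matrix.cons_val_fin_one]
      rw [← mul_assoc, hee, one_mul, sub_self, abs_zero, max_eq_right (abs_nonneg _),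
        ← mul_div_assoc e, Real.div_rpow hpx.le hx.le, Real.rpow_sub_one hx.ne']
      rw [show ∀ N : ℝ, |N| / x = |N / x| from fun N => by rw [abs_div, abs_of_pos hx]]
      congr 1
      have := (Real.rpow_pos_of_pos hx (β : ℝ)).ne'
      field_simp

theorem IsBiLipGerm.eventually_continuousOn (hΦ : IsBiLipGerm Φ) {β : ℝ} (hβ : 0 < β) (e t : ℝ) :
    ∃ δ > 0, ContinuousOn (fun x => Φ (chart β e x 0 t) 0) (Set.Ioo 0 δ) := by
  obtain ⟨-, A, B, hA, hB, S, hS, h⟩ := hΦ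
  obtain ⟨δ, hδ, hsub⟩ := mem_nhdsGT_iff_exists_Ioo_subset.1
    ((tendsto_chart (β := β) (e := e) hβ 0 t).eventually_mem hS)
  refine ⟨δ, hδ, ?_⟩
  have h1 : ContinuousOn Φ S := (LipschitzOnWith.of_dist_le_mul (K := ⟨B, hB.le⟩)
    fun p hp q hq => (h p hp q hq).2).continuousOn
  have h2 : ContinuousOn (fun x => chart β e x 0 t) (Set.Ioo 0 δ) := by
    refine continuousOn_pi.2 fun i => ?_
    have hr : ContinuousOn (fun x : ℝ => x ^ β) (Set.Ioo 0 δ) := fun x hx =>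
      (Real.continuousAt_rpow_const x β (Or.inr hβ.le)).continuousWithinAt
    fin_cases i
    · simp only [chart, mul_zero, add_zero, Fin.zero_eta, Matrix.cons_val_zero]
      fun_prop
    · simp only [chart, Fin.mk_one, Matrix.cons_val_one, Matrix.cons_val_fin_one]
      exact hr.mul_const t
  exact (continuous_apply 0).comp_continuousOn (h1.comp h2 hsub)

/-- By the intermediate value theorem, a sign change at arbitrarily small scales would produce
zeros. -/
theorem IsBiLipGerm.exists_sign (hΦ : IsBiLipGerm Φ) {β : ℝ} (hβ : 0 < β) {e t : ℝ}
    (h : ∀ᶠ x in 𝓝[>] 0, Φ (chart β e x 0 t) 0 ≠ 0) :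
    ∃ e' : ℝ, |e'| = 1 ∧ ∀ᶠ x in 𝓝[>] 0, 0 < e' * Φ (chart β e x 0 t) 0 := by
  obtain ⟨δ, hδ, hc⟩ := hΦ.eventually_continuousOn hβ e t
  obtain ⟨ε, hε, hsub⟩ := mem_nhdsGT_iff_exists_Ioo_subset.1
    (inter_mem h (Ioo_mem_nhdsGT hδ))
  have hc' := hc.mono fun x hx => (hsub hx).2
  have hI : Set.Ioo 0 ε ∈ 𝓝[>] (0 : ℝ) := Ioo_mem_nhdsGT hε
  have hne : ∀ x ∈ Set.Ioo 0 ε, Φ (chart β e x 0 t) 0 ≠ 0 := fun x hx => (hsub hx).1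
  by_cases hneg : ∃ x ∈ Set.Ioo 0 ε, Φ (chart β e x 0 t) 0 < 0
  · obtain ⟨x, hx, hx0⟩ := hneg
    refine ⟨-1, by simp, ?_⟩
    filter_upwards [hI] with y hy
    by_contra! hy0
    obtain ⟨z, hz, hz0⟩ := isPreconnected_Ioo.intermediate_value hx hy hc'
      ⟨hx0.le, by linarith⟩
    exact hne z hz hz0
  · push Not at hneg
    refine ⟨1, by simp, ?_⟩
    filter_upwards [hI] with y hy
    rw [one_mul]
    exact lt_of_le_of_ne (hneg y hy) (hne y hy).symm

/-- Zero branches of `F` in opposite half-planes are not mapped into the same half-plane. -/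
theorem not_same_sign (hβ : 1 < β) (hF : IsQuasihomogeneous β d F)
    (hG : IsQuasihomogeneous β d G) (hΦ : IsBiLipGerm Φ) (hT : Transforms Φ F G) {t₁ t₂ e' : ℝ}
    (he' : |e'| = 1) (ht₁ : (height F 1).eval t₁ = 0) (ht₂ : (height F (-1)).eval t₂ = 0)
    (h₁ : ∀ᶠ x in 𝓝[>] 0, 0 < e' * Φ (chart β 1 x 0 t₁) 0)
    (h₂ : ∀ᶠ x in 𝓝[>] 0, 0 < e' * Φ (chart β (-1) x 0 t₂) 0) : False := by
  have hβ1 : (1 : ℝ) < β := by exact_mod_cast hβ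
  have hβ0 : (0 : ℝ) < β := by linarith
  obtain ⟨T, hT0, hTb⟩ := exists_bound_zeros hG he'
  obtain ⟨_, B₁, -, hB₁, hAB₁⟩ := hΦ.curve_bounds hβ1 (abs_one) t₁
  obtain ⟨δ, hδ, hc⟩ := hΦ.eventually_continuousOn hβ0 (-1) t₂
  have hlim₁ : Tendsto (fun x => Φ (chart β 1 x 0 t₁)) (𝓝[>] 0) (𝓝 0) :=
    hΦ.continuousAt.comp (tendsto_chart hβ0 0 t₁)
  have hlim₂ : Tendsto (fun x => Φ (chart β (-1) x 0 t₂)) (𝓝[>] 0) (𝓝 0) :=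
    hΦ.continuousAt.comp (tendsto_chart hβ0 0 t₂)
  obtain ⟨-, A, B, hA, hB, S, hS, hΦS⟩ := hΦ
  obtain ⟨ε, hε, hsub⟩ := mem_nhdsGT_iff_exists_Ioo_subset.1
    (inter_mem (inter_mem h₂ ((tendsto_chart (β := β) (e := -1) hβ0 0 t₂).eventually
      (hT.and hS))) (Ioo_mem_nhdsGT hδ))
  have hε2 : ε / 2 ∈ Set.Ioo 0 ε := ⟨half_pos hε, half_lt_self hε⟩
  have hsmall : ∀ᶠ x in 𝓝[>] (0 : ℝ), 2 * T * B₁ ^ (β : ℝ) * x ^ ((β : ℝ) - 1) < A := by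
    have := (tendsto_rpow_zero (sub_pos.2 hβ1)).const_mul (2 * T * B₁ ^ (β : ℝ))
    exact this.eventually_lt_const (by simpa using hA)
  have hlt : ∀ᶠ x in 𝓝[>] (0 : ℝ), e' * Φ (chart β 1 x 0 t₁) 0 <
      e' * Φ (chart β (-1) (ε / 2) 0 t₂) 0 := by
    have := (tendsto_pi_nhds.1 hlim₁ 0).const_mul e'
    exact this.eventually_lt_const (by simpa using (hsub hε2).1.1)
  obtain ⟨x, hx : 0 < x, hx1, hxT, hxS, hab, hxs, hxlt⟩ := (eventually_mem_nhdsWithin.and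
    (h₁.and (((tendsto_chart hβ0 0 t₁).eventually hT).and
    (((tendsto_chart hβ0 0 t₁).eventually_mem hS).and (hAB₁.and (hsmall.and hlt)))))).exists
  obtain ⟨y₀, hy₀, hy₀lt⟩ : ∃ y ∈ Set.Ioo 0 ε,
      e' * Φ (chart β (-1) y 0 t₂) 0 < e' * Φ (chart β 1 x 0 t₁) 0 := by
    have := (tendsto_pi_nhds.1 hlim₂ 0).const_mul e'
    obtain ⟨y, hy, hy'⟩ := ((this.eventually_lt_const (u := e' * Φ (chart β 1 x 0 t₁) 0)
      (by simpa using hx1)).and (Ioo_mem_nhdsGT hε)).exists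
    exact ⟨y, hy', hy⟩
  -- Some point of the second branch has an image with the same first coordinate as the image of the
  -- point at `x`.
  obtain ⟨y, hy, hxy⟩ := isPreconnected_Ioo.intermediate_value hy₀ hε2
    ((hc.mono fun x hx => (hsub hx).2).const_mul e') ⟨hy₀lt.le, hxlt.le⟩
  have he0' : e' ≠ 0 := by rintro rfl; simp at he'
  have hu : Φ (chart β (-1) y 0 t₂) 0 = Φ (chart β 1 x 0 t₁) 0 := mul_left_cancel₀ he0' hxy
  obtain ⟨⟨hy1, hyT, hyS⟩, -⟩ := hsub hy
  rw [eval_curve hF hx, ht₁, mul_zero] at hxT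
  rw [eval_curve hF hy.1, ht₂, mul_zero] at hyT
  have hv1 := hTb _ hx1 hxT
  have hv2 := hTb _ hy1 hyT
  rw [hu] at hv2
  have hd := (hΦS _ hxS _ hyS).1
  rw [dist_fin_two (Φ _), hu, sub_self, abs_zero, max_eq_right (abs_nonneg _)] at hd
  have hd0 := abs_sub_le_dist (chart β 1 x 0 t₁) (chart β (-1) y 0 t₂) 0
  have hd1 : x ≤ |chart β 1 x 0 t₁ 0 - chart β (-1) y 0 t₂ 0| := by
    simp only [chart, mul_zero, add_zero, Matrix.cons_val_zero]
    rw [abs_of_pos (by linarith [hy.1])]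
    linarith [hy.1]
  have hd2 := (mul_le_mul_of_nonneg_left (hd1.trans hd0) hA.le).trans hd
  have hd3 := abs_sub (Φ (chart β 1 x 0 t₁) 1) (Φ (chart β (-1) y 0 t₂) 1)
  have hd4 : |Φ (chart β 1 x 0 t₁) 0| ^ (β : ℝ) ≤ (B₁ * x) ^ (β : ℝ) :=
    Real.rpow_le_rpow (abs_nonneg _) ((le_max_left _ _).trans hab.2) hβ0.le
  rw [Real.mul_rpow hB₁.le hx.le] at hd4
  rw [Real.rpow_sub_one hx.ne', ← mul_div_assoc, div_lt_iff₀ hx] at hxs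
  -- The two image points differ only vertically, by at most `2 T (B₁ x) ^ β < A x`, while their
  -- preimages, on opposite sides of the y-axis, are at distance at least `x`.
  nlinarith

end

/-! ### The exceptional case settled, and limit speeds -/

section

variable {β : ℚ} {d : ℝ} {F G : MvPolynomial (Fin 2) ℝ} {Φ Ψ : (Fin 2 → ℝ) → (Fin 2 → ℝ)}

theorem exists_zero_of_nonempty (hF : IsQuasihomogeneous β d F) {e : ℝ} (he : |e| = 1)
    {p : Fin 2 → ℝ} (hp : p ∈ V F) (hpe : 0 < e * p 0) : ∃ t, (height F e).eval t = 0 := by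
  have h1 : ![p 0, p 1] = p := by ext i; fin_cases i <;> rfl
  have h2 : MvPolynomial.eval p F = 0 := hp
  have h3 : p 0 ≠ 0 := by intro h; simp [h] at hpe
  rw [← h1, hF.eval_eq_height he hpe] at h2
  exact ⟨_, (mul_eq_zero.1 h2).resolve_left (Real.rpow_pos_of_pos (abs_pos.2 h3) _).ne'⟩

theorem exponent_unique (hβ : 1 < β) {k l : ℕ} (h : (k : ℝ) + β * k = l + β * l) : k = l := by
  have hβ1 : (1 : ℝ) < β := by exact_mod_cast hβ
  have h1 : (1 + (β : ℝ)) * ((k : ℝ) - l) = 0 := by linarith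
  exact_mod_cast sub_eq_zero.1 ((mul_eq_zero.1 h1).resolve_left (by linarith))

theorem frequently_zero_or_frequently_pos (u : ℝ → ℝ) :
    (∃ᶠ x in 𝓝[>] (0 : ℝ), u x = 0) ∨ ∃ e' : ℝ, |e'| = 1 ∧ ∃ᶠ x in 𝓝[>] (0 : ℝ), 0 < e' * u x := by
  by_contra! h
  obtain ⟨h0, h1⟩ := h
  have h2 := h1 1 abs_one
  have h3 := h1 (-1) (by simp)
  obtain ⟨x, hx0, hx1, hx2⟩ := (h0.and (h2.and h3)).exists
  rcases lt_trichotomy (u x) 0 with h | h | h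
  · linarith
  · exact hx0 h
  · linarith

/-- One exceptional branch makes every height function of `F` equivalent to the same power. Any
half-plane then contains a zero branch of `G`, and either case of the analysis of `Ψ` along it leads
to that power again. -/
theorem polyLipEquiv_of_exceptional (hβ : 1 < β) (hF : IsQuasihomogeneous β d F)
    (hG : IsQuasihomogeneous β d G) (hΦ : IsBiLipGerm Φ) (hΨ : IsBiLipGerm Ψ)
    (hΦΨ : ∀ᶠ q in 𝓝 0, Φ (Ψ q) = q) (hT : Transforms Φ F G)
    (hzero : ∀ e : ℝ, |e| = 1 → ∃ t, (height F e).eval t = 0) {e : ℝ} (he : |e| = 1)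
    {t₀ : ℝ} (ht₀ : (height F e).eval t₀ = 0)
    (hfr : ∃ᶠ x in 𝓝[>] 0, Φ (chart β e x 0 t₀) 0 = 0) {e₁ e₂ : ℝ} (he₁ : |e₁| = 1)
    (he₂ : |e₂| = 1) : PolyLipEquiv (height F e₁) (height G e₂) := by
  obtain ⟨m, hm, hm01, hk, hfe⟩ := exists_of_exceptional hβ hF hG hΦ hT he ht₀ hfr
  have hd := hG.exponent_eq hm
  rw [hm01] at hd
  obtain ⟨⟨n, hn, hn0, hn1, hsign⟩, hmax, hfe'⟩ :=
    exists_of_height_equiv_pow hβ hF he hk hd hfe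
  have hfall : ∀ e₁ : ℝ, |e₁| = 1 →
      PolyLipEquiv (height F e₁) (Polynomial.C (G.coeff m) * Polynomial.X ^ m 1) := by
    intro e₁ he₁
    rcases abs_eq_abs.1 (he₁.trans he.symm) with rfl | rfl
    · exact hfe
    · exact hfe'
  refine (hfall e₁ he₁).trans ?_
  obtain ⟨s₀, hs₀⟩ := exists_zero_height hβ hF hG hΦ hΨ hΦΨ hT hzero hn (hn0.trans hn1.symm)
    (by rwa [hn1]) (by rwa [hn1]) he₂
  have hT' := hT.inverse hΨ hΦΨ
  rcases frequently_zero_or_frequently_pos fun x => Ψ (chart β e₂ x 0 s₀) 0 with h | ⟨e', he', h⟩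
  · obtain ⟨l, hl, hl01, -, hge⟩ := exists_of_exceptional hβ hG hF hΨ hT' he₂ hs₀ h
    have hdl := hF.exponent_eq hl
    rw [hl01, ← hd] at hdl
    have hlm := exponent_unique hβ hdl
    -- Both dominant monomials have equal exponents in `X` and `Y` and the same weight `d`, so they
    -- coincide; `hsign` then makes the two pure powers comparable.
    have hln : l = n := hF.eq_of_apply_one_eq hl hn (hlm.trans hn1.symm)
    rw [hlm, hln] at hge
    exact (hge.trans (polyLipEquiv_pow_pow (MvPolynomial.mem_support_iff.1 hn)
      (MvPolynomial.mem_support_iff.1 hm) hsign)).symm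
  · exact ((polyLipEquiv_of_regular hβ hG hF hΨ hT' he₂ he' hs₀ h).trans (hfall e' he')).symm

/-- The sign of the limit speed along the `x`-axis determines the half-plane into which the zero
branches of `F` are mapped. -/
theorem eventually_pos_of_speed (hβ : 1 < β) (hΦ : IsBiLipGerm Φ) {e l : ℝ} (he : |e| = 1)
    (h : Tendsto (fun x => Φ ![e * x, 0] 0 / x) (𝓝[>] 0) (𝓝 l)) {e' : ℝ} (hl : 0 < e' * l)
    (t : ℝ) : ∀ᶠ x in 𝓝[>] 0, 0 < e' * Φ (chart β e x 0 t) 0 := by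
  have hβ1 : (1 : ℝ) < β := by exact_mod_cast hβ
  have hβ0 : (0 : ℝ) < β := by linarith
  obtain ⟨-, A, B, hA, hB, S, hS, hΦS⟩ := hΦ
  have h0 : ∀ x : ℝ, chart β e x 0 0 = ![e * x, 0] := fun x => by simp [chart]
  -- The branch differs from the half-axis by `x ^ β |t| = o(x)`, so its image has the same limit
  -- speed.
  have h1 : Tendsto (fun x => Φ (chart β e x 0 t) 0 / x - Φ ![e * x, 0] 0 / x) (𝓝[>] 0)
      (𝓝 0) := by
    have h2 := ((tendsto_rpow_zero (sub_pos.2 hβ1)).mul_const |t|).const_mul B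
    rw [zero_mul, mul_zero] at h2
    refine squeeze_zero_norm' ?_ h2
    filter_upwards [(tendsto_chart (β := β) (e := e) hβ0 0 t).eventually_mem hS,
      (tendsto_chart (β := β) (e := e) hβ0 0 0).eventually_mem hS, self_mem_nhdsWithin]
      with x h3 h4 (hx : 0 < x)
    have h5 := (abs_sub_le_dist _ _ 0).trans (hΦS _ h3 _ h4).2
    rw [dist_chart he hx, sub_self, abs_zero, sub_zero, max_eq_right (abs_nonneg _), h0] at h5
    rw [← sub_div, Real.norm_eq_abs, abs_div, abs_of_pos hx, div_le_iff₀ hx,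
      Real.rpow_sub_one hx.ne']
    calc _ ≤ _ := h5
      _ = _ := by field_simp
  have h2 : Tendsto (fun x => e' * (Φ (chart β e x 0 t) 0 / x)) (𝓝[>] 0) (𝓝 (e' * l)) := by
    simpa using (h1.add h).const_mul e'
  filter_upwards [h2.eventually_const_lt hl, self_mem_nhdsWithin] with x hx (hx0 : 0 < x)
  rw [← mul_div_assoc] at hx
  exact (div_pos_iff_of_pos_right hx0).1 hx

theorem HasRightSpeed.tendsto {l : ℝ} (h : HasRightSpeed Φ l) :
    Tendsto (fun x => Φ ![1 * x, 0] 0 / x) (𝓝[>] 0) (𝓝 l) := by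
  simp only [one_mul]
  exact h

theorem HasLeftSpeed.tendsto {l : ℝ} (h : HasLeftSpeed Φ l) :
    Tendsto (fun x => Φ ![-1 * x, 0] 0 / x) (𝓝[>] 0) (𝓝 (-l)) := by
  have h1 : Tendsto (fun x : ℝ => -x) (𝓝[>] 0) (𝓝[<] 0) := by
    simpa using tendsto_neg_nhdsGT_neg (a := (0 : ℝ))
  refine ((Tendsto.comp h h1).neg).congr fun x => ?_
  simp [div_neg]

end

end LipEq

/-! ### The main theorem -/

open LipEq in
theorem mainTheorem1 (β : ℚ) (hβ : 1 < β) (d : ℝ) (hd : 1 ≤ d)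
    (F G : MvPolynomial (Fin 2) ℝ)
    (hF : LipEq.IsQuasihomogeneous β d F) (hG : LipEq.IsQuasihomogeneous β d G)
    (hVright : (LipEq.V F ∩ {p | 0 < p 0}).Nonempty)
    (hVleft : (LipEq.V F ∩ {p | p 0 < 0}).Nonempty)
    (hFG : LipEq.RSemialgLipEquiv F G) :
    ((LipEq.PolyLipEquiv (LipEq.rightHeight F) (LipEq.rightHeight G) ∧
        LipEq.PolyLipEquiv (LipEq.leftHeight F) (LipEq.leftHeight G)) ∨
      (LipEq.PolyLipEquiv (LipEq.rightHeight F) (LipEq.leftHeight G) ∧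
        LipEq.PolyLipEquiv (LipEq.leftHeight F) (LipEq.rightHeight G))) ∧
    ∀ Φ : (Fin 2 → ℝ) → (Fin 2 → ℝ),
      LipEq.IsSemialgBiLipGerm Φ → LipEq.Transforms Φ F G →
        (LipEq.IsDirect β d Φ →
          LipEq.PolyLipEquiv (LipEq.rightHeight F) (LipEq.rightHeight G) ∧
            LipEq.PolyLipEquiv (LipEq.leftHeight F) (LipEq.leftHeight G)) ∧
        (LipEq.IsReverse β d Φ →
          LipEq.PolyLipEquiv (LipEq.rightHeight F) (LipEq.leftHeight G) ∧
            LipEq.PolyLipEquiv (LipEq.leftHeight F) (LipEq.rightHeight G)) := by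
  simp only [rightHeight_eq, leftHeight_eq]
  have hn1 : |(-1 : ℝ)| = 1 := by simp
  obtain ⟨t₁, ht₁⟩ : ∃ t, (height F 1).eval t = 0 := by
    obtain ⟨p, hp, hp0⟩ := hVright
    exact exists_zero_of_nonempty hF abs_one hp (by simpa using hp0)
  obtain ⟨t₂, ht₂⟩ : ∃ t, (height F (-1)).eval t = 0 := by
    obtain ⟨p, hp, hp0⟩ := hVleft
    exact exists_zero_of_nonempty hF hn1 hp (by simpa using hp0)
  have hzero : ∀ e : ℝ, |e| = 1 → ∃ t, (height F e).eval t = 0 := by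
    intro e he
    rcases eq_or_eq_neg_of_abs_eq he with rfl | rfl
    · exact ⟨t₁, ht₁⟩
    · exact ⟨t₂, ht₂⟩
  constructor
  · obtain ⟨Φ, hΦ', hT⟩ := hFG
    obtain ⟨Ψ, hΨ, hΦΨ⟩ := hΦ'.exists_inverse
    have hΦ := hΦ'.isBiLipGerm
    have hβ0 : (0 : ℝ) < β := by exact_mod_cast zero_lt_one.trans hβ
    -- An exceptional branch on either side makes all four height functions equivalent, so either
    -- alternative may be chosen.
    by_cases hx₁ : ∃ᶠ x in 𝓝[>] 0, Φ (chart β 1 x 0 t₁) 0 = 0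
    · have h := fun {e₁ e₂ : ℝ} => polyLipEquiv_of_exceptional hβ hF hG hΦ hΨ hΦΨ hT hzero
        abs_one ht₁ hx₁ (e₁ := e₁) (e₂ := e₂)
      exact Or.inl ⟨h abs_one abs_one, h hn1 hn1⟩
    by_cases hx₂ : ∃ᶠ x in 𝓝[>] 0, Φ (chart β (-1) x 0 t₂) 0 = 0
    · have h := fun {e₁ e₂ : ℝ} => polyLipEquiv_of_exceptional hβ hF hG hΦ hΨ hΦΨ hT hzero
        hn1 ht₂ hx₂ (e₁ := e₁) (e₂ := e₂)
      exact Or.inl ⟨h abs_one abs_one, h hn1 hn1⟩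
    obtain ⟨e₁, he₁, h₁⟩ := hΦ.exists_sign hβ0 (not_frequently.1 hx₁)
    obtain ⟨e₂, he₂, h₂⟩ := hΦ.exists_sign hβ0 (not_frequently.1 hx₂)
    have hreg₁ := polyLipEquiv_of_regular hβ hF hG hΦ hT abs_one he₁ ht₁ h₁.frequently
    have hreg₂ := polyLipEquiv_of_regular hβ hF hG hΦ hT hn1 he₂ ht₂ h₂.frequently
    rcases eq_or_eq_neg_of_abs_eq he₁ with rfl | rfl <;>
      rcases eq_or_eq_neg_of_abs_eq he₂ with rfl | rfl
    · exact (not_same_sign hβ hF hG hΦ hT he₁ ht₁ ht₂ h₁ h₂).elim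
    · exact Or.inl ⟨hreg₁, hreg₂⟩
    · exact Or.inr ⟨hreg₁, hreg₂⟩
    · exact (not_same_sign hβ hF hG hΦ hT he₁ ht₁ ht₂ h₁ h₂).elim
  · intro Φ hΦ' hT
    have hΦ := hΦ'.isBiLipGerm
    -- Nonzero speeds keep the branches off the y-axis, so the regular case suffices. On the left
    -- the speed is negated because the branch is parametrized by `x > 0`.
    have hreg₁ := fun {e' l : ℝ} (he' : |e'| = 1) (hl : HasRightSpeed Φ l) (h : 0 < e' * l) =>
      polyLipEquiv_of_regular hβ hF hG hΦ hT abs_one he' ht₁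
        (eventually_pos_of_speed hβ hΦ abs_one hl.tendsto h t₁).frequently
    have hreg₂ := fun {e' l : ℝ} (he' : |e'| = 1) (hl : HasLeftSpeed Φ l) (h : 0 < e' * -l) =>
      polyLipEquiv_of_regular hβ hF hG hΦ hT hn1 he' ht₂
        (eventually_pos_of_speed hβ hΦ hn1 hl.tendsto h t₂).frequently
    refine ⟨?_, ?_⟩
    · rintro ⟨-, ⟨l, hl, hr⟩, l', hl', hr'⟩
      exact ⟨hreg₁ abs_one hr (by linarith), hreg₂ hn1 hr' (by linarith)⟩
    · rintro ⟨-, ⟨l, hl, hr⟩, l', hl', hr'⟩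
      exact ⟨hreg₁ hn1 hr (by linarith), hreg₂ abs_one hr' (by linarith)⟩
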